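/- Let $r\ge 2$ and $d\ge 1$ be integers, let $P=\mathbb{C}[X_0,\dots,X_r]$ with irrelevant ideal $\mathbf m=(X_0,\dots,X_r)$, and let $f\in P$ be a reduced (i.e. square-free) homogeneous polynomial of degree $d$. Let $X=V(f)\subset\mathbb{P}^r$, $J(f)=(\partial f/\partial X_0,\dots,\partial f/\partial X_r)$ and $R(f)=P/J(f)$. Let $H^0_{\mathbf m}(R(f))$ be the $0$-th local cohomology of $R(f)$, that is, the submodule of the elements annihilated by some power of $\mathbf m$. Let $\mathcal{J}_{f/X}\subset\mathcal{O}_X$ be the image in $\mathcal O_X$ of the ideal sheaf associated to $J(f)$. Let $T\langle X\rangle$ be the sheaf of logarithmic vector fields along $X$, i.e. the kernel of the surjection $$\eta: T_{\mathbb{P}^r}\to \mathcal{J}_{f/X}(d),\qquad \eta\Big(\sum_i A_i\frac{\partial}{\partial X_i}\Big)=\sum_i A_i\frac{\partial f}{\partial X_i},$$ where, by the Euler sequence, local vector fields on $\mathbb{P}^r$ are written as $\sum_i A_i\,\partial/\partial X_i$ with $A_i$ local sections of $\mathcal{O}(1)$, modulo multiples of $\sum_i X_i\,\partial/\partial X_i$.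 Put $$H^1_*(T\langle X\rangle(-d))=\bigoplus_{k\in\mathbb{Z}}H^1(\mathbb{P}^r,T\langle X\rangle(k-d)),$$ a graded $P$-module. Then there is a canonical isomorphism of graded $P$-modules $$H^0_{\mathbf m}(R(f))\;\cong\; H^1_*(T\langle X\rangle(-d)).$$ Explicitly, if $a\in P$ is homogeneous of degree $k$ and its class in $R(f)$ lies in $H^0_{\mathbf m}(R(f))$, then the image of $a$ in $H^0(\mathcal{O}_X(k))$ is a global section of $\mathcal{J}_{f/X}(k)$, and the isomorphism sends the class of $a$ to the image of this section under the connecting homomorphism $H^0(\mathcal{J}_{f/X}(k))\to H^1(T\langle X\rangle(k-d))$ of the exact sequence $0\to T\langle X\rangle(k-d)\to T_{\mathbb{P}^r}(k-d)\to\mathcal{J}_{f/X}(k)\to 0$. In particular, if $X$ is nonsingular (at every point of $X$ some $\partial f/\partial X_i$ is nonzero), this isomorphism is defined on all of $R(f)$: there is an isomorphism of graded $P$-modules $R(f)\cong H^1_*(T\langle X\rangle(-d))$ which restricts to the one above on $H^0_{\mathbf m}(R(f))$. -/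

import Mathlib

noncomputable section

namespace LogSheaf

open CategoryTheory TopologicalSpace Opposite MvPolynomial
open scoped DirectSum

-- this instance competes with the quiver structure underlying a category
attribute [-instance] CategoryTheory.catToReflQuiver

/-! ### Projective space and its graded coordinate ring -/

/-- The polynomial ring `ℂ[X₀, …, X_r]`. -/
abbrev P (r : ℕ) : Type := MvPolynomial (Fin (r + 1)) ℂ

/-- The standard grading of the polynomial ring. -/
abbrev gradP (r : ℕ) : ℕ → Submodule ℂ (P r) := homogeneousSubmodule (Fin (r + 1)) ℂ

instance (r : ℕ) : GradedAlgebra (gradP r) := MvPolynomial.gradedAlgebra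

/-- The underlying topological space of the projective space `ℙ^r = Proj ℂ[X₀, …, X_r]`. -/
abbrev ProjSpace (r : ℕ) : TopCat.{0} := ProjectiveSpectrum.top (gradP r)

/-- Sheaves of abelian groups on `ℙ^r`. -/
abbrev AbSheaf (r : ℕ) : Type 1 :=
  CategoryTheory.Sheaf (Opens.grothendieckTopology (ProjSpace r)) AddCommGrpCat.{0}

variable {r : ℕ}

/-- The multiplicative set of polynomials outside the homogeneous prime `x`. -/
abbrev compl (x : ProjectiveSpectrum (gradP r)) : Submonoid (P r) :=
  x.asHomogeneousIdeal.toIdeal.primeCompl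

/-! ### The sheaf associated with a graded module -/

section Assoc

variable {M N : Type} [AddCommGroup M] [Module (P r) M] [AddCommGroup N] [Module (P r) N]

variable (r) in
/-- The family `𝓜` of additive subgroups (the homogeneous pieces of the module `M`) is compatible
with multiplication by homogeneous polynomials. -/
class GradedPieces (𝓜 : ℤ → AddSubgroup M) : Prop where
  smul_mem : ∀ {i : ℕ} {j : ℤ} {a : P r} {m : M}, a ∈ gradP r i → m ∈ 𝓜 j → a • m ∈ 𝓜 (j + i)

/-- A family of germs over `U` is a fraction `m / s` with `s` homogeneous of some degree `i` and
without zeros on `U`, and `m` homogeneous of degree `k + i`. -/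
def IsFrac (𝓜 : ℤ → AddSubgroup M) (k : ℤ) {U : Opens (ProjSpace r)}
    (f : ∀ x : U, LocalizedModule (compl x.1) M) : Prop :=
  ∃ (i : ℕ) (m : M) (s : P r) (_ : m ∈ 𝓜 (k + i)) (_ : s ∈ gradP r i)
    (hs : ∀ x : U, s ∈ compl x.1), ∀ x : U, f x = LocalizedModule.mk m ⟨s, hs x⟩

/-- Being locally a fraction of degree `k`. -/
def isLocFrac (𝓜 : ℤ → AddSubgroup M) (k : ℤ) :
    TopCat.LocalPredicate fun x : ProjSpace r => LocalizedModule (compl x) M :=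
  TopCat.PrelocalPredicate.sheafify
    { pred := fun f => IsFrac 𝓜 k f
      res := by
        rintro V U i f ⟨j, m, s, hm, hs, hx, h⟩
        exact ⟨j, m, s, hm, hs, fun x => hx (i x), fun x => h (i x)⟩ }

/-- Sections over `U` of the `k`-th twist of the sheaf associated with `M`. -/
def sections (𝓜 : ℤ → AddSubgroup M) [GradedPieces r 𝓜] (k : ℤ) (U : Opens (ProjSpace r)) :
    AddSubgroup (∀ x : U, LocalizedModule (compl x.1) M) where
  carrier := {f | (isLocFrac 𝓜 k).pred f}
  zero_mem' := fun x => ⟨U, x.2, 𝟙 U, 0, 0, 1, (𝓜 _).zero_mem, SetLike.one_mem_graded _,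
    fun x => (compl x.1).one_mem, fun x => (LocalizedModule.zero_mk _).symm⟩
  neg_mem' := by
    intro f hf x
    obtain ⟨V, hV, ι, i, m, s, hm, hs, hx, h⟩ := hf x
    refine ⟨V, hV, ι, i, -m, s, (𝓜 _).neg_mem hm, hs, hx, fun y => ?_⟩
    have := h y
    rw [LocalizedModule.mk_neg, ← this]; rfl
  add_mem' := by
    intro f g hf hg x
    obtain ⟨V, hV, ι, i, m, s, hm, hs, hx, h⟩ := hf x
    obtain ⟨W, hW, κ, j, n, t, hn, ht, hy, h'⟩ := hg x
    refine ⟨V ⊓ W, ⟨hV, hW⟩, Opens.infLELeft V W ≫ ι, i + j, t • m + s • n, s * t,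
      (𝓜 _).add_mem ?_ ?_, SetLike.mul_mem_graded hs ht,
      fun z => (compl z.1).mul_mem (hx ⟨z.1, z.2.1⟩) (hy ⟨z.1, z.2.2⟩), fun z => ?_⟩
    · have := GradedPieces.smul_mem ht hm
      rwa [add_assoc, ← Nat.cast_add] at this
    · have := GradedPieces.smul_mem hs hn
      rwa [add_assoc, ← Nat.cast_add, add_comm j i] at this
    · have h1 := h ⟨z.1, z.2.1⟩
      have h2 := h' ⟨z.1, z.2.2⟩
      have h3 := LocalizedModule.mk_add_mk (m1 := m) (m2 := n)
        (s1 := (⟨s, hx ⟨z.1, z.2.1⟩⟩ : compl z.1)) (s2 := ⟨t, hy ⟨z.1, z.2.2⟩⟩)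
      refine Eq.trans ?_ h3
      rw [← h1, ← h2]; rfl

/-- The presheaf of sections of the `k`-th twist of the sheaf associated with `M`. -/
def assocPresheaf (𝓜 : ℤ → AddSubgroup M) [GradedPieces r 𝓜] (k : ℤ) :
    TopCat.Presheaf AddCommGrpCat.{0} (ProjSpace r) where
  obj U := AddCommGrpCat.of (sections 𝓜 k U.unop)
  map {U V} i := AddCommGrpCat.ofHom
    { toFun := fun f => ⟨fun x => f.1 (i.unop x), (isLocFrac 𝓜 k).res i.unop f.1 f.2⟩
      map_zero' := rfl
      map_add' := fun _ _ => rfl }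

/-- The sheaf `M(k)^~` on `ℙ^r` associated with the `k`-th twist of the graded module `M`
(with homogeneous pieces `𝓜`): its sections over `U` are the families of germs that are locally
fractions `m / s` with `m ∈ M` and `s` homogeneous polynomials, `deg m - deg s = k`. -/
def assoc (𝓜 : ℤ → AddSubgroup M) [GradedPieces r 𝓜] (k : ℤ) : AbSheaf r :=
  ⟨assocPresheaf 𝓜 k,
    (TopCat.Presheaf.isSheaf_iff_isSheaf_comp (forget AddCommGrpCat) _).mpr
      (TopCat.Presheaf.isSheaf_of_iso
        (NatIso.ofComponents (fun _ => Iso.refl _) (by cat_disch) :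
          (TopCat.subsheafToTypes (isLocFrac 𝓜 k)).1 ≅ assocPresheaf 𝓜 k ⋙ forget AddCommGrpCat)
        (TopCat.subsheafToTypes (isLocFrac 𝓜 k)).property)⟩

/-- The morphism of sheaves `M(k)^~ ⟶ N(l)^~` induced by a linear map `M → N` that maps
homogeneous elements of degree `k + i` to homogeneous elements of degree `l + i`. -/
def assocMap {𝓜 : ℤ → AddSubgroup M} [GradedPieces r 𝓜] {𝓝 : ℤ → AddSubgroup N} [GradedPieces r 𝓝]
    (φ : M →ₗ[P r] N) (k l : ℤ) (hφ : ∀ i, ∀ m ∈ 𝓜 (k + i), φ m ∈ 𝓝 (l + i)) :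
    (assoc 𝓜 k : AbSheaf r) ⟶ assoc 𝓝 l :=
  ⟨{ app := fun U => AddCommGrpCat.ofHom
      { toFun := fun f => ⟨fun x => LocalizedModule.map (compl x.1) φ (f.1 x), by
          intro x
          obtain ⟨V, hV, ι, i, m, s, hm, hs, hx, h⟩ := f.2 x
          refine ⟨V, hV, ι, i, φ m, s, hφ i m hm, hs, hx, fun y => ?_⟩
          have := h y
          dsimp only at this ⊢
          rw [this, LocalizedModule.map_mk]⟩
        map_zero' := by ext x; exact map_zero _
        map_add' := fun f g => by ext x; exact map_add _ _ _ }
     naturality := by intros; rfl }⟩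

/-- The global section of `M(k)^~` defined by a homogeneous element of `M` of degree `k`. -/
def assocSection (𝓜 : ℤ → AddSubgroup M) [GradedPieces r 𝓜] (k : ℤ) (m : M) (hm : m ∈ 𝓜 k) :
    (assoc 𝓜 k : AbSheaf r).obj.obj (op ⊤) :=
  (⟨fun _ => LocalizedModule.mk m 1, fun x => ⟨⊤, trivial, 𝟙 _, 0, m, 1, by simpa using hm,
    SetLike.one_mem_graded _, fun x => (compl x.1).one_mem, fun _ => rfl⟩⟩ : sections 𝓜 k ⊤)

/-- Multiplication by a homogeneous polynomial `g` of degree `j`, as a map `M(k)^~ ⟶ M(l)^~`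
with `l = k + j`. -/
def assocMul (𝓜 : ℤ → AddSubgroup M) [GradedPieces r 𝓜] {j : ℕ} (g : gradP r j) (k l : ℤ)
    (h : k + j = l) : (assoc 𝓜 k : AbSheaf r) ⟶ assoc 𝓜 l :=
  assocMap (LinearMap.lsmul (P r) M g.1) k l (by
    intro i m hm
    have := GradedPieces.smul_mem g.2 hm
    rw [← h]
    convert! this using 2
    ring)

/-- The homogeneous pieces of a quotient of a graded module. -/
def quotPiece (𝓜 : ℤ → AddSubgroup M) (K : Submodule (P r) M) (j : ℤ) : AddSubgroup (M ⧸ K) :=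
  (𝓜 j).map K.mkQ.toAddMonoidHom

/-- The homogeneous pieces of a submodule of a graded module. -/
def subPiece (𝓜 : ℤ → AddSubgroup M) (K : Submodule (P r) M) (j : ℤ) : AddSubgroup K :=
  (𝓜 j).comap K.subtype.toAddMonoidHom

instance (𝓜 : ℤ → AddSubgroup M) [GradedPieces r 𝓜] (K : Submodule (P r) M) :
    GradedPieces r (quotPiece 𝓜 K) where
  smul_mem := by
    rintro i j a _ ha ⟨m, hm, rfl⟩
    exact ⟨a • m, GradedPieces.smul_mem ha hm, rfl⟩

instance (𝓜 : ℤ → AddSubgroup M) [GradedPieces r 𝓜] (K : Submodule (P r) M) :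
    GradedPieces r (subPiece 𝓜 K) where
  smul_mem := fun {_ _ _ m} ha hm => GradedPieces.smul_mem (m := (m : M)) ha hm

end Assoc

/-! ### The graded modules of the construction -/

/-- The homogeneous polynomials of degree `j ∈ ℤ` (only `0` when `j < 0`). -/
def polyPiece (r : ℕ) (j : ℤ) : AddSubgroup (P r) where
  carrier := {p | p = 0 ∨ ∃ n : ℕ, (n : ℤ) = j ∧ p.IsHomogeneous n}
  zero_mem' := Or.inl rfl
  neg_mem' := by
    rintro p (rfl | ⟨n, hn, hp⟩)
    · exact Or.inl neg_zero
    · exact Or.inr ⟨n, hn, hp.neg⟩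
  add_mem' := by
    rintro p q (rfl | ⟨n, hn, hp⟩) hq
    · rwa [zero_add]
    · rcases hq with rfl | ⟨m, hm, hq⟩
      · rw [add_zero]; exact Or.inr ⟨n, hn, hp⟩
      · obtain rfl : n = m := by omega
        exact Or.inr ⟨n, hn, hp.add hq⟩

instance : GradedPieces r (polyPiece r) where
  smul_mem := by
    rintro i j a m ha (rfl | ⟨n, hn, hm⟩)
    · exact Or.inl (smul_zero _)
    · refine Or.inr ⟨i + n, by push_cast; omega, ?_⟩
      exact ((mem_homogeneousSubmodule i a).1 ha).mul hm

/-- Degree `j` homogeneous vector fields `∑ Aᵢ ∂/∂Xᵢ` on affine space: the coefficients `Aᵢ` are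
homogeneous of degree `j + 1`, so that the associated sheaf is `𝒪(1)^{r+1}`. -/
def fieldPiece (r : ℕ) (j : ℤ) : AddSubgroup (Fin (r + 1) → P r) where
  carrier := {A | ∀ i, A i ∈ polyPiece r (j + 1)}
  zero_mem' := fun _ => (polyPiece r _).zero_mem
  neg_mem' := fun h i => (polyPiece r _).neg_mem (h i)
  add_mem' := fun h h' i => (polyPiece r _).add_mem (h i) (h' i)

instance : GradedPieces r (fieldPiece r) where
  smul_mem := by
    intro i j a A ha hA l
    have := GradedPieces.smul_mem ha (hA l)
    rwa [add_right_comm] at this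

/-- The multiples of the Euler vector field `∑ Xᵢ ∂/∂Xᵢ`. -/
def eulerSpan (r : ℕ) : Submodule (P r) (Fin (r + 1) → P r) := Submodule.span (P r) {fun i => X i}

/-- The sheaf `T_{ℙ^r}(k)`: by the Euler sequence `0 → 𝒪 → 𝒪(1)^{r+1} → T_{ℙ^r} → 0` it is
associated with the graded module of polynomial vector fields modulo the Euler vector field. -/
abbrev tangentSheaf (r : ℕ) (k : ℤ) : AbSheaf r := assoc (quotPiece (fieldPiece r) (eulerSpan r)) k

/-- The gradient ideal `J(f)`. -/
def gradientIdeal (f : P r) : Ideal (P r) := Ideal.span (Set.range fun i => pderiv i f)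

/-- The jacobian ring `R(f) = P / J(f)`. -/
abbrev JacobianRing (f : P r) : Type := P r ⧸ gradientIdeal f

/-- The `0`-th local cohomology `H⁰_𝔪(R(f))`: the elements of the jacobian ring annihilated by some
power of the irrelevant ideal `𝔪 = (X₀, …, X_r)`. -/
def localCohomZero (f : P r) : Submodule (P r) (JacobianRing f) where
  carrier := {x | ∃ n : ℕ, ∀ a ∈ Ideal.span (Set.range (X : Fin (r + 1) → P r)) ^ n, a • x = 0}
  zero_mem' := ⟨0, fun _ _ => smul_zero _⟩
  add_mem' := by
    rintro x y ⟨n, hx⟩ ⟨m, hy⟩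
    refine ⟨n + m, fun a ha => ?_⟩
    rw [smul_add, hx a (Ideal.pow_le_pow_right (Nat.le_add_right n m) ha),
      hy a (Ideal.pow_le_pow_right (Nat.le_add_left m n) ha), add_zero]
  smul_mem' := by
    rintro c x ⟨n, hx⟩
    refine ⟨n, fun a ha => ?_⟩
    rw [smul_comm, hx a ha, smul_zero]

/-- The homogeneous coordinate ring `P / (f)` of `X = V(f)`, as a `P`-module. -/
abbrev CoordRing (f : P r) : Type := P r ⧸ (Ideal.span {f} : Submodule (P r) (P r))

/-- The sheaf `𝒪_X(k)`. -/
abbrev structSheafX (f : P r) (k : ℤ) : AbSheaf r :=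
  assoc (quotPiece (polyPiece r) (Ideal.span {f} : Submodule (P r) (P r))) k

/-- The global section of `𝒪_X(k)` defined by a homogeneous polynomial of degree `k`. -/
def polySection (f : P r) (k : ℤ) (a : P r) (ha : a ∈ polyPiece r k) :
    (structSheafX f k).obj.obj (op ⊤) :=
  assocSection (quotPiece (polyPiece r) (Ideal.span {f} : Submodule (P r) (P r))) k
    (Submodule.Quotient.mk a) ⟨a, ha, rfl⟩

/-- The image of `J(f)` in the coordinate ring of `X`. -/
def jacobianModule (f : P r) : Submodule (P r) (CoordRing f) :=
  Submodule.map (Submodule.mkQ (Ideal.span {f} : Submodule (P r) (P r))) (gradientIdeal f)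

/-- The homogeneous pieces of the image of `J(f)` in the coordinate ring of `X`. -/
abbrev jacobianPiece (f : P r) : ℤ → AddSubgroup (jacobianModule f) :=
  subPiece (quotPiece (polyPiece r) (Ideal.span {f} : Submodule (P r) (P r))) (jacobianModule f)

/-- The twists `𝒥_{f/X}(k)` of the jacobian ideal sheaf `𝒥_{f/X} ⊆ 𝒪_X`. -/
abbrev jacobianSheafX (f : P r) (k : ℤ) : AbSheaf r := assoc (jacobianPiece f) k

/-- The group of global sections `H⁰(𝒥_{f/X}(k))`. -/
abbrev H0Jacobian (f : P r) (k : ℤ) : Type := (jacobianSheafX f k).obj.obj (op ⊤)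

/-- The inclusion `𝒥_{f/X}(k) ⟶ 𝒪_X(k)`. -/
def jacobianIncl (f : P r) (k : ℤ) : jacobianSheafX f k ⟶ structSheafX f k :=
  assocMap (jacobianModule f).subtype k k (fun _ _ hm => hm)

/-- The map on global sections `H⁰(𝒥_{f/X}(k)) → H⁰(𝒪_X(k))` induced by the inclusion. -/
def H0JacobianIncl (f : P r) (k : ℤ) (s : H0Jacobian f k) : (structSheafX f k).obj.obj (op ⊤) :=
  (jacobianIncl f k).hom.app (op ⊤) s

/-- The `P`-linear map `∑ Aᵢ ∂/∂Xᵢ ↦ ∑ Aᵢ ∂f/∂Xᵢ`. -/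
def gradPairing (f : P r) : (Fin (r + 1) → P r) →ₗ[P r] P r :=
  ∑ i, (LinearMap.proj i : (Fin (r + 1) → P r) →ₗ[P r] P r).smulRight (pderiv i f)

lemma gradPairing_apply (f : P r) (A : Fin (r + 1) → P r) :
    gradPairing f A = ∑ i, A i * pderiv i f := by
  simp [gradPairing]

lemma gradPairing_mem (f : P r) (A : Fin (r + 1) → P r) : gradPairing f A ∈ gradientIdeal f := by
  rw [gradPairing_apply]
  exact Ideal.sum_mem _ fun i _ => Ideal.mul_mem_left _ _ (Ideal.subset_span ⟨i, rfl⟩)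

variable {d : ℕ} {f : P r}

/-- The `P`-linear map underlying `η`, from polynomial vector fields modulo the Euler vector field
to `J(f)` modulo `f`, `∑ Aᵢ ∂/∂Xᵢ ↦ ∑ Aᵢ ∂f/∂Xᵢ`. It is well defined by Euler's formula. -/
def etaLin (hf : f.IsHomogeneous d) :
    ((Fin (r + 1) → P r) ⧸ eulerSpan r) →ₗ[P r] jacobianModule f :=
  Submodule.liftQ (eulerSpan r)
    (LinearMap.codRestrict (jacobianModule f)
      ((Submodule.mkQ (Ideal.span {f} : Submodule (P r) (P r))).comp (gradPairing f))
      (fun A => ⟨_, gradPairing_mem f A, rfl⟩))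
    (by
      rw [eulerSpan, Submodule.span_le, Set.singleton_subset_iff]
      refine Subtype.ext ?_
      refine (Submodule.Quotient.mk_eq_zero _).2 ?_
      rw [gradPairing_apply, hf.sum_X_mul_pderiv, nsmul_eq_mul]
      exact Ideal.mul_mem_left _ _ (Ideal.mem_span_singleton_self f))

lemma etaLin_mk (hf : f.IsHomogeneous d) (A : Fin (r + 1) → P r) :
    (etaLin hf (Submodule.Quotient.mk A)).1 = Submodule.Quotient.mk (gradPairing f A) := rfl

lemma gradPairing_deg (hf : f.IsHomogeneous d) (j : ℤ) {A : Fin (r + 1) → P r}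
    (hA : A ∈ fieldPiece r j) : gradPairing f A ∈ polyPiece r (j + d) := by
  rw [gradPairing_apply]
  refine AddSubgroup.sum_mem _ fun i _ => ?_
  rcases Nat.eq_zero_or_pos d with rfl | hd
  · rw [totalDegree_eq_zero_iff_eq_C.1 (Nat.le_zero.1 hf.totalDegree_le), pderiv_C, mul_zero]
    exact AddSubgroup.zero_mem _
  · rcases hA i with h | ⟨n, hn, h⟩
    · rw [h, zero_mul]; exact AddSubgroup.zero_mem _
    · exact Or.inr ⟨n + (d - 1), by omega, h.mul hf.pderiv⟩

lemma etaLin_deg (hf : f.IsHomogeneous d) (j l : ℤ) (h : j + d = l)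
    (m : (Fin (r + 1) → P r) ⧸ eulerSpan r) (hm : m ∈ quotPiece (fieldPiece r) (eulerSpan r) j) :
    etaLin hf m ∈ jacobianPiece f l := by
  obtain ⟨A, hA, rfl⟩ := hm
  subst h
  exact ⟨gradPairing f A, gradPairing_deg hf j hA, rfl⟩

/-- In each degree, `η` is onto on the level of graded modules. -/
lemma etaLin_surj (hf : f.IsHomogeneous d) (j l : ℤ) (h : j + d = l) (m : jacobianModule f)
    (hm : m ∈ jacobianPiece f l) :
    ∃ t ∈ quotPiece (fieldPiece r) (eulerSpan r) j, etaLin hf t = m := by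
  classical
  obtain ⟨m, hmem⟩ := m
  obtain ⟨g, hg, rfl⟩ := hm
  rcases hg with rfl | ⟨n, hn, hg⟩
  · exact ⟨0, AddSubgroup.zero_mem _, Subtype.ext (by rw [map_zero]; exact (map_zero _).symm)⟩
  obtain ⟨u, hu, hug⟩ := hmem
  obtain ⟨A, rfl⟩ : ∃ A, gradPairing f A = u := by
    obtain ⟨c, hc⟩ := (Ideal.mem_span_range_iff_exists_fun).1 hu
    exact ⟨c, by rw [gradPairing_apply, hc]⟩
  obtain ⟨b, hb⟩ : ∃ b, b * f = gradPairing f A - g :=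
    Ideal.mem_span_singleton'.1 ((Submodule.Quotient.eq _).1 hug)
  -- compare the components of degree `n`
  have hdf : f ∈ gradP r d := hf
  have hgd : ((DirectSum.decompose (gradP r) g n : gradP r n) : P r) = g :=
    DirectSum.decompose_of_mem_same (gradP r) hg
  have hcomp : ((DirectSum.decompose (gradP r) (b * f) n : gradP r n) : P r) =
      (∑ i, ((DirectSum.decompose (gradP r) (A i * pderiv i f) n : gradP r n) : P r)) - g := by
    rw [hb, gradPairing_apply, DirectSum.decompose_sub, DirectSum.decompose_sum]
    simp only [DirectSum.sub_apply, AddSubgroupClass.coe_sub, hgd]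
    congr 1
    simp
  have hbf : ((DirectSum.decompose (gradP r) (b * f) n : gradP r n) : P r) ∈ Ideal.span {f} := by
    rw [DirectSum.coe_decompose_mul_of_right_mem (gradP r) n hdf]
    split_ifs
    · exact Ideal.mul_mem_left _ _ (Ideal.mem_span_singleton_self f)
    · exact Ideal.zero_mem _
  rcases Nat.eq_zero_or_pos d with rfl | hd
  · refine ⟨0, AddSubgroup.zero_mem _, Subtype.ext ?_⟩
    rw [map_zero]
    refine ((Submodule.Quotient.mk_eq_zero _).2 ?_).symm
    have h0 : gradPairing f A = 0 := by
      rw [gradPairing_apply]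
      refine Finset.sum_eq_zero fun i _ => ?_
      rw [totalDegree_eq_zero_iff_eq_C.1 (Nat.le_zero.1 hf.totalDegree_le), pderiv_C, mul_zero]
    rw [h0, zero_sub] at hb
    rw [← neg_neg g, ← hb]
    exact Submodule.neg_mem _ (Ideal.mul_mem_left _ _ (Ideal.mem_span_singleton_self f))
  let B : Fin (r + 1) → P r := fun i =>
    if d - 1 ≤ n then (DirectSum.decompose (gradP r) (A i) (n - (d - 1)) : gradP r _) else 0
  have hB : gradPairing f B = g + (DirectSum.decompose (gradP r) (b * f) n : gradP r n) := by
    rw [hcomp, gradPairing_apply, add_sub_cancel]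
    refine Finset.sum_congr rfl fun i _ => ?_
    rw [DirectSum.coe_decompose_mul_of_right_mem (gradP r) n (i := d - 1) hf.pderiv]
    simp only [B]
    split_ifs <;> simp
  refine ⟨Submodule.Quotient.mk B, ⟨B, fun i => ?_, rfl⟩, Subtype.ext ?_⟩
  · simp only [B]
    split_ifs with hle
    · refine Or.inr ⟨n - (d - 1), by omega,
        (DirectSum.decompose (gradP r) (A i) (n - (d - 1))).2⟩
    · exact Or.inl rfl
  · rw [etaLin_mk, hB]
    refine (Submodule.Quotient.eq _).2 ?_
    rwa [add_sub_cancel_left]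

/-- The morphism `η : T_{ℙ^r}(k - d) ⟶ 𝒥_{f/X}(k)`, `∑ Aᵢ ∂/∂Xᵢ ↦ ∑ Aᵢ ∂f/∂Xᵢ`. -/
def eta (hf : f.IsHomogeneous d) (k : ℤ) : tangentSheaf r (k - d) ⟶ jacobianSheafX f k :=
  assocMap (etaLin hf) (k - d) k fun i m hm => etaLin_deg hf _ _ (by ring) m hm

instance (hf : f.IsHomogeneous d) (k : ℤ) : Epi (eta hf k) := by
  refine (TopCat.Sheaf.isLocallySurjective_iff_epi (eta hf k)).1 ?_
  refine (TopCat.Presheaf.isLocallySurjective_iff _).2 fun U t x hx => ?_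
  obtain ⟨V, hV, ι, i, m, s, hm, hs, hy, h⟩ := t.2 ⟨x, hx⟩
  obtain ⟨t', ht', rfl⟩ := etaLin_surj hf (k - d + i) (k + i) (by ring) m hm
  refine ⟨V, ι.le, ⟨⟨fun y => LocalizedModule.mk t' ⟨s, hy y⟩, fun y =>
    ⟨V, y.2, 𝟙 V, i, t', s, ht', hs, hy, fun _ => rfl⟩⟩, ?_⟩, hV⟩
  refine Subtype.ext (funext fun y => ?_)
  refine Eq.trans ?_ (h y).symm
  exact LocalizedModule.map_mk (S := compl y.1) (etaLin hf) t' ⟨s, hy y⟩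

/-- The sheaf `T⟨X⟩(k - d)`, where `T⟨X⟩ = ker (η : T_{ℙ^r} → 𝒥_{f/X}(d))` is the sheaf of
logarithmic vector fields along `X = V(f)`. -/
def logSheaf (hf : f.IsHomogeneous d) (k : ℤ) : AbSheaf r := Limits.kernel (eta hf k)

/-- The inclusion `T⟨X⟩(k - d) ⟶ T_{ℙ^r}(k - d)`. -/
def logIncl (hf : f.IsHomogeneous d) (k : ℤ) : logSheaf hf k ⟶ tangentSheaf r (k - d) :=
  Limits.kernel.ι (eta hf k)

instance (hf : f.IsHomogeneous d) (k : ℤ) : Mono (logIncl hf k) :=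
  inferInstanceAs (Mono (Limits.kernel.ι (eta hf k)))

/-- The exact sequence `0 → T⟨X⟩(k - d) → T_{ℙ^r}(k - d) → 𝒥_{f/X}(k) → 0`. -/
def logSeq (hf : f.IsHomogeneous d) (k : ℤ) : ShortComplex (AbSheaf r) :=
  ShortComplex.mk (logIncl hf k) (eta hf k) (Limits.kernel.condition _)

lemma logSeq_shortExact (hf : f.IsHomogeneous d) (k : ℤ) : (logSeq hf k).ShortExact where
  exact := ShortComplex.exact_kernel _
  mono_f := inferInstanceAs (Mono (logIncl hf k))
  epi_g := inferInstanceAs (Epi (eta hf k))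

/-! ### The graded module `H¹_*(T⟨X⟩(-d))` -/

/-- The cohomology group `H¹(ℙ^r, T⟨X⟩(k - d))`. -/
abbrev H1Log (hf : f.IsHomogeneous d) (k : ℤ) : Type := Sheaf.H (logSheaf hf k) 1

/-- The connecting homomorphism `H⁰(𝒥_{f/X}(k)) → H¹(T⟨X⟩(k - d))`. -/
def connecting (hf : f.IsHomogeneous d) (k : ℤ) (s : H0Jacobian f k) :
    H1Log hf k :=
  ((Sheaf.H.equiv₀ (jacobianSheafX f k) Limits.isTerminalTop).symm s).comp
    (logSeq_shortExact hf k).extClass (zero_add 1)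

lemma eta_mul (hf : f.IsHomogeneous d) {j : ℕ} (g : gradP r j) (k l : ℤ) (h : k + j = l) :
    eta hf k ≫ assocMul (jacobianPiece f) g k l h =
      assocMul (quotPiece (fieldPiece r) (eulerSpan r)) g (k - d) (l - d) (by omega) ≫
        eta hf l := by
  ext U t
  refine Subtype.ext (funext fun x => ?_)
  change LocalizedModule.map (compl x.1) (LinearMap.lsmul (P r) _ g.1)
      (LocalizedModule.map (compl x.1) (etaLin hf) (t.1 x)) =
    LocalizedModule.map (compl x.1) (etaLin hf)
      (LocalizedModule.map (compl x.1) (LinearMap.lsmul (P r) _ g.1) (t.1 x))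
  induction t.1 x using LocalizedModule.induction_on with
  | h m s => simp [LocalizedModule.map_mk]

/-- Multiplication `T⟨X⟩(k - d) ⟶ T⟨X⟩(l - d)` by a homogeneous polynomial of degree
`j = l - k`. -/
def logMul (hf : f.IsHomogeneous d) {j : ℕ} (g : gradP r j) (k l : ℤ) (h : k + j = l) :
    logSheaf hf k ⟶ logSheaf hf l :=
  Limits.kernel.map (eta hf k) (eta hf l)
    (assocMul (quotPiece (fieldPiece r) (eulerSpan r)) g (k - d) (l - d) (by omega))
    (assocMul (jacobianPiece f) g k l h) (eta_mul hf g k l h)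

lemma logMul_ι (hf : f.IsHomogeneous d) {j : ℕ} (g : gradP r j) (k l : ℤ) (h : k + j = l) :
    logMul hf g k l h ≫ logIncl hf l = logIncl hf k ≫
      assocMul (quotPiece (fieldPiece r) (eulerSpan r)) g (k - d) (l - d) (by omega) :=
  Limits.kernel.lift_ι _ _ _

/-- The action of a homogeneous polynomial on the cohomology groups `H¹(T⟨X⟩(k - d))`. -/
def logAct (hf : f.IsHomogeneous d) {j : ℕ} (g : gradP r j) (k l : ℤ) (h : k + j = l) :
    H1Log hf k →+ H1Log hf l :=
  Sheaf.H.map (logMul hf g k l h) 1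

section Action

variable {M : Type} [AddCommGroup M] [Module (P r) M] (𝓜 : ℤ → AddSubgroup M) [GradedPieces r 𝓜]

lemma assocMul_add {j : ℕ} (g g' : gradP r j) (k l : ℤ) (h : k + j = l) :
    assocMul 𝓜 (g + g') k l h = assocMul 𝓜 g k l h + assocMul 𝓜 g' k l h := by
  ext U t
  refine Subtype.ext (funext fun x => ?_)
  change LocalizedModule.map (compl x.1) (LinearMap.lsmul (P r) M (g.1 + g'.1)) (t.1 x) =
    LocalizedModule.map (compl x.1) (LinearMap.lsmul (P r) M g.1) (t.1 x) +
    LocalizedModule.map (compl x.1) (LinearMap.lsmul (P r) M g'.1) (t.1 x)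
  simp

lemma assocMul_one (e : gradP r 0) (he : e.1 = 1) (k : ℤ) (h : k + (0 : ℕ) = k) :
    assocMul 𝓜 e k k h = 𝟙 _ := by
  ext U t
  refine Subtype.ext (funext fun x => ?_)
  change LocalizedModule.map (compl x.1) (LinearMap.lsmul (P r) M e.1) (t.1 x) = t.1 x
  rw [he]
  induction t.1 x using LocalizedModule.induction_on with
  | h m s => simp [LocalizedModule.map_mk]

lemma assocMul_mul {i j : ℕ} (g : gradP r i) (g' : gradP r j) (e : gradP r (i + j))
    (he : e.1 = g.1 * g'.1) (k l l' : ℤ) (h : k + j = l)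
    (h' : l + i = l') (h'' : k + (i + j : ℕ) = l') :
    assocMul 𝓜 e k l' h'' =
      assocMul 𝓜 g' k l h ≫ assocMul 𝓜 g l l' h' := by
  ext U t
  refine Subtype.ext (funext fun x => ?_)
  change LocalizedModule.map (compl x.1) (LinearMap.lsmul (P r) M e.1) (t.1 x) =
    LocalizedModule.map (compl x.1) (LinearMap.lsmul (P r) M g.1)
      (LocalizedModule.map (compl x.1) (LinearMap.lsmul (P r) M g'.1) (t.1 x))
  induction t.1 x using LocalizedModule.induction_on with
  | h m s => simp only [LocalizedModule.map_mk, he, LinearMap.lsmul_apply, mul_smul]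

end Action

lemma logAct_add (hf : f.IsHomogeneous d) {j : ℕ} (g g' : gradP r j) (k l : ℤ) (h : k + j = l) :
    logAct hf (g + g') k l h = logAct hf g k l h + logAct hf g' k l h := by
  ext c
  have : logMul hf (g + g') k l h = logMul hf g k l h + logMul hf g' k l h := by
    rw [← cancel_mono (logIncl hf l), Preadditive.add_comp, logMul_ι, logMul_ι,
      logMul_ι, assocMul_add, Preadditive.comp_add]
  simp [logAct, this]

lemma logAct_one (hf : f.IsHomogeneous d) (e : gradP r 0) (he : e.1 = 1) (k : ℤ) (h : k + (0 : ℕ) = k) (c : H1Log hf k) :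
    logAct hf e k k h c = c := by
  have : logMul hf e k k h = 𝟙 _ := by
    rw [← cancel_mono (logIncl hf k), logMul_ι, assocMul_one _ _ he, Category.id_comp]
    exact Category.comp_id _
  simp [logAct, this]

lemma logAct_mul (hf : f.IsHomogeneous d) {i j : ℕ} (g : gradP r i) (g' : gradP r j)
    (e : gradP r (i + j)) (he : e.1 = g.1 * g'.1) (k l l' : ℤ) (h : k + j = l) (h' : l + i = l') (h'' : k + (i + j : ℕ) = l')
    (c : H1Log hf k) :
    logAct hf e k l' h'' c =
      logAct hf g l l' h' (logAct hf g' k l h c) := by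
  have : logMul hf e k l' h'' =
      logMul hf g' k l h ≫ logMul hf g l l' h' := by
    rw [← cancel_mono (logIncl hf l'), Category.assoc, logMul_ι, logMul_ι,
      ← Category.assoc, logMul_ι, Category.assoc, assocMul_mul _ _ _ _ he _ (l - d) _ (by omega)
        (by omega)]
  rw [logAct, this, Sheaf.H.map_comp_apply]; rfl

/-- The action of `ℕ` on `ℤ` by translation, used to index graded modules. -/
abbrev shiftVAdd : VAdd ℕ ℤ := ⟨fun n k => k + n⟩

attribute [local instance] shiftVAdd

instance (hf : f.IsHomogeneous d) :
    DirectSum.Gmodule (fun n => gradP r n) (fun k => H1Log hf k) where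
  smul {j k} g c := logAct hf g k (j +ᵥ k) rfl c
  one_smul := by
    rintro ⟨k, c⟩
    have key : ∀ (l : ℤ) (h : k + (0 : ℕ) = l),
        (⟨l, logAct hf (GradedMonoid.GOne.one (A := fun n => gradP r n)) k l h c⟩ :
          GradedMonoid fun k => H1Log hf k) = ⟨k, c⟩ := by
      intro l h
      obtain rfl : l = k := by simpa using h.symm
      rw [logAct_one hf _ rfl]
    exact key _ rfl
  mul_smul := by
    rintro ⟨i, g⟩ ⟨j, g'⟩ ⟨k, c⟩
    have key : ∀ (l : ℤ) (h : k + (i + j : ℕ) = l),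
        (⟨l, logAct hf (GradedMonoid.GMul.mul (A := fun n => gradP r n) g g') k l h c⟩ :
          GradedMonoid fun k => H1Log hf k) =
          ⟨k + j + i, logAct hf g (k + j) (k + j + i) rfl (logAct hf g' k (k + j) rfl c)⟩ := by
      intro l h
      obtain rfl : l = k + j + i := by rw [← h]; push_cast; ring
      rw [← logAct_mul hf g g' (GradedMonoid.GMul.mul (A := fun n => gradP r n) g g') rfl]
    exact key _ rfl
  smul_add := fun _ _ _ => map_add _ _ _
  smul_zero := fun _ => map_zero _
  add_smul := fun g g' c => by
    rw [logAct_add]; rfl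
  zero_smul := fun {j k} c => by
    have := logAct_add hf (0 : gradP r j) 0 k (j +ᵥ k) rfl
    rw [add_zero, left_eq_add] at this
    rw [this]; rfl

/-- The graded `P`-module `H¹_*(T⟨X⟩(-d)) = ⨁_{k ∈ ℤ} H¹(ℙ^r, T⟨X⟩(k - d))`. -/
def H1StarLog (hf : f.IsHomogeneous d) : Type := ⨁ k : ℤ, H1Log hf k

instance (hf : f.IsHomogeneous d) : AddCommGroup (H1StarLog hf) :=
  inferInstanceAs (AddCommGroup (⨁ k : ℤ, H1Log hf k))

instance (hf : f.IsHomogeneous d) : Module (P r) (H1StarLog hf) :=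
  Module.compHom (⨁ k : ℤ, H1Log hf k)
    (DirectSum.decomposeRingEquiv (gradP r) : P r ≃+* ⨁ n, gradP r n).toRingHom

/-- The inclusion of the summand of degree `k`. -/
def H1StarLog.of (hf : f.IsHomogeneous d) (k : ℤ) : H1Log hf k →+ H1StarLog hf :=
  DirectSum.of (fun k => H1Log hf k) k

/-- Multiplication by a homogeneous polynomial on `H¹_*` is induced by multiplication on sheaves. -/
lemma H1StarLog.smul_of (hf : f.IsHomogeneous d) {j : ℕ} (g : gradP r j) (k l : ℤ)
    (h : k + j = l) (c : H1Log hf k) :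
    (g : P r) • H1StarLog.of hf k c = H1StarLog.of hf l (logAct hf g k l h c) := by
  obtain rfl : l = j +ᵥ k := h.symm
  change DirectSum.decompose (gradP r) (g : P r) • DirectSum.of (fun k => H1Log hf k) k c = _
  rw [DirectSum.decompose_coe]
  have := DirectSum.Gmodule.of_smul_of (fun n => gradP r n) (fun k => H1Log hf k) g c
  refine Eq.trans this ?_
  rfl

/-- The hypersurface `V(f) ⊆ ℙ^r` is nonsingular: at each of its points some partial derivative of
`f` does not vanish. -/
def IsNonsingular (f : P r) : Prop :=
  ∀ x : Fin (r + 1) → ℂ, x ≠ 0 → eval x f = 0 → ∃ i, eval x (pderiv i f) ≠ 0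

end LogSheaf

end

noncomputable section

namespace LogSheaf

open CategoryTheory TopologicalSpace Opposite MvPolynomial
open scoped DirectSum

variable {r : ℕ}

/-! ### Regular sequences of powers of variables -/

/-! The defining sequence of `T⟨X⟩` is replaced by one on `ℙ^r` that does not mention `X`. Let `K`
be the kernel of `𝒪(1)^{r+1}(k - d) → J(f)^~(k)`, `A ↦ ∑ Aᵢ ∂f/∂Xᵢ`. The Euler field `E` is sent to
`d·f`, which is nonzero, so `K` contains no nonzero multiple of `E`. Conversely, if `A` is sent to
`v·f`, then `A - (v/d)E` lies in `K` and has the same class modulo `E`. Hence the projection `K →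
T⟨X⟩(k - d)` is an isomorphism (`isIso_gradKernelToLog`), and it is compatible with the connecting
homomorphisms (`map_gradConnecting`).

Since `H¹(𝒪(n)) = 0` for `r ≥ 2`, the group `H¹(K)` is the cokernel of `H⁰(𝒪(1)^{r+1}(k - d)) →
H⁰(J(f)^~(k))`. Global sections of `𝒪(n)` are homogeneous polynomials, so the source consists of
polynomial vector fields, with image the degree `k` part of `J(f)`. The target is the degree `k`
part of the saturation of `J(f)` (`exists_isGivenBy`, `exists_section_of_isSaturated`). The quotient
is the degree `k` part of `H⁰_𝔪(R(f))`.

The vanishing of `H¹(𝒪(n))` is proved by hand. Embedding in an injective sheaf reduces it to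
splitting Čech cocycles on arbitrarily fine covers (`subsingleton_H_one_of_cechOneVanishes`). On a
finite cover by basic open sets, clearing denominators turns a cocycle into a Koszul cocycle of
polynomials. This is a coboundary because the ideal of the denominators contains a regular sequence
of length three (`exists_koszul_primitive`).

The isomorphism is built backwards: the relation `IsConnectingClass` between polynomials and
cohomology classes defines a `P`-linear map from `H¹_*` to `R(f)`, which is shown to be injective
with image `H⁰_𝔪(R(f))`. -/

/-- Membership in a monomial ideal is tested on each monomial of the support, and multiplication by
`X k ^ N` changes only the exponent of `k`, which no generator involves. This makes powers of
distinct variables a regular sequence. -/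
lemma X_pow_mul_mem_span {σ : Type*} {S : Set σ} {k : σ} (hk : k ∉ S) (N : ℕ)
    {e : MvPolynomial σ ℂ}
    (h : X k ^ N * e ∈ Ideal.span ((fun i => (X i : MvPolynomial σ ℂ) ^ N) '' S)) :
    e ∈ Ideal.span ((fun i => (X i : MvPolynomial σ ℂ) ^ N) '' S) := by
  classical
  have key : (fun i => (X i : MvPolynomial σ ℂ) ^ N) '' S =
      (fun s => monomial s (1 : ℂ)) '' ((fun i => Finsupp.single i N) '' S) := by
    rw [Set.image_image]
    simp only [X_pow_eq_monomial]
  rw [key, mem_ideal_span_monomial_image] at h ⊢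
  intro m hm
  obtain ⟨_, ⟨i, hi, rfl⟩, hle⟩ := h (Finsupp.single k N + m) (by
    rw [mem_support_iff] at hm ⊢
    rw [X_pow_eq_monomial, coeff_monomial_mul, one_mul]
    exact hm)
  refine ⟨_, ⟨i, hi, rfl⟩, ?_⟩
  have hik : k ≠ i := by rintro rfl; exact hk hi
  rw [Finsupp.single_le_iff] at hle ⊢
  simpa [Finsupp.single_apply, hik] using hle

/-- The vanishing of the first cohomology of the Koszul-type complex of a family `g` whose ideal
contains a regular sequence `y, z, w`. -/
lemma exists_koszul_primitive {A ι : Type*} [CommRing A] [Fintype ι] (g : ι → A) (b : ι → ι → A)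
    (hb : ∀ i j k, g i * b j k - g j * b i k + g k * b i j = 0) (y z w : A)
    (hy : y ∈ Ideal.span (Set.range g)) (hz : z ∈ Ideal.span (Set.range g))
    (hw : w ∈ Ideal.span (Set.range g))
    (hy0 : ∀ a, y * a = 0 → a = 0) (hz0 : ∀ a, z * a ∈ Ideal.span {y} → a ∈ Ideal.span {y})
    (hw0 : ∀ a, w * a ∈ Ideal.span {y, z} → a ∈ Ideal.span {y, z}) :
    ∃ c : ι → A, ∀ i j, b i j = g j * c i - g i * c j := by
  obtain ⟨u, rfl⟩ := (Ideal.mem_span_range_iff_exists_fun).1 hy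
  obtain ⟨v, rfl⟩ := (Ideal.mem_span_range_iff_exists_fun).1 hz
  obtain ⟨t, rfl⟩ := (Ideal.mem_span_range_iff_exists_fun).1 hw
  set y := ∑ i, u i * g i with hyd
  set z := ∑ i, v i * g i with hzd
  -- Contracting `b` with the coefficients of `y` gives a primitive of `y * b`. The elements `z` and
  -- `w` then serve to divide this primitive by `y`.
  set c : ι → A := fun i => ∑ k, u k * b i k with hc
  have h1 : ∀ i j, y * b i j = g j * c i - g i * c j := by
    intro i j
    rw [hyd, Finset.sum_mul, hc]
    simp only [Finset.mul_sum]
    rw [← Finset.sum_sub_distrib]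
    refine Finset.sum_congr rfl fun k _ => ?_
    linear_combination u k * hb i j k
  set e : A := ∑ k, v k * c k with he
  have h2 : ∀ i, ∃ q, z * c i = g i * e + y * q := by
    intro i
    refine ⟨∑ k, v k * b i k, ?_⟩
    rw [hzd, he, Finset.sum_mul, Finset.mul_sum, Finset.mul_sum, ← Finset.sum_add_distrib]
    refine Finset.sum_congr rfl fun k _ => ?_
    linear_combination -v k * h1 i k
  have h3 : (∑ k, t k * g k) * e ∈ Ideal.span {y, z} := by
    rw [Finset.sum_mul]
    refine Ideal.sum_mem _ fun k _ => ?_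
    obtain ⟨q, hq⟩ := h2 k
    refine Ideal.mem_span_pair.2 ⟨-(t k * q), t k * c k, ?_⟩
    linear_combination t k * hq
  obtain ⟨α, β, hαβ⟩ := Ideal.mem_span_pair.1 (hw0 _ h3)
  -- Multiples of `g` cancel in `g j * c i - g i * c j`, so only `c - β g` matters, and this is
  -- divisible by `y`.
  have h4 : ∀ i, ∃ q, c i = β * g i + y * q := by
    intro i
    obtain ⟨q, hq⟩ := h2 i
    obtain ⟨p, hp⟩ := Ideal.mem_span_singleton'.1 (hz0 (c i - β * g i)
      (Ideal.mem_span_singleton'.2 ⟨g i * α + q, by linear_combination -hq + g i * hαβ⟩))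
    exact ⟨p, by linear_combination -hp⟩
  choose q hq using h4
  refine ⟨q, fun i j => ?_⟩
  refine sub_eq_zero.1 (hy0 _ ?_)
  linear_combination h1 i j + g j * hq i - g i * hq j

/-! ### Homogeneous components indexed by the integers -/

/-- The homogeneous component of degree `n ∈ ℤ` of a polynomial. -/
def polyProj (r : ℕ) (n : ℤ) : P r →+ P r :=
  if 0 ≤ n then (homogeneousComponent n.toNat : P r →ₗ[ℂ] P r).toAddMonoidHom else 0

lemma polyProj_natCast (n : ℕ) (p : P r) : polyProj r n p = homogeneousComponent n p := by
  simp [polyProj]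

lemma polyProj_of_neg {n : ℤ} (h : n < 0) (p : P r) : polyProj r n p = 0 := by
  simp [polyProj, not_le.2 h]

lemma polyProj_mem (n : ℤ) (p : P r) : polyProj r n p ∈ polyPiece r n := by
  rcases lt_or_ge n 0 with h | h
  · rw [polyProj_of_neg h]; exact AddSubgroup.zero_mem _
  · lift n to ℕ using h
    rw [polyProj_natCast]
    exact Or.inr ⟨n, rfl, homogeneousComponent_isHomogeneous n p⟩

lemma polyProj_of_mem {n : ℤ} {p : P r} (h : p ∈ polyPiece r n) : polyProj r n p = p := by
  rcases h with rfl | ⟨m, rfl, h⟩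
  · exact map_zero _
  · rw [polyProj_natCast, homogeneousComponent_of_mem h, if_pos rfl]

lemma polyProj_mul {e : ℕ} {g : P r} (hg : g ∈ gradP r e) (n : ℤ) (p : P r) :
    polyProj r (n + e) (g * p) = g * polyProj r n p := by
  have hdec : ∀ (m : ℕ) (q : P r),
      homogeneousComponent m q = (DirectSum.decompose (gradP r) q m : gradP r m) := by
    intro m q
    exact (decomposition.decompose'_apply q m).symm
  rcases lt_or_ge (n + e) 0 with h | h
  · rw [polyProj_of_neg h, polyProj_of_neg (by omega), mul_zero]
  · obtain ⟨m, hm⟩ := Int.eq_ofNat_of_zero_le h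
    rw [hm, polyProj_natCast, hdec, DirectSum.coe_decompose_mul_of_left_mem (gradP r) m hg]
    split_ifs with hle
    · obtain rfl : n = ((m - e : ℕ) : ℤ) := by omega
      rw [polyProj_natCast, hdec]
    · rw [polyProj_of_neg (by omega), mul_zero]

lemma mul_mem_polyPiece {e : ℕ} {g p : P r} (hg : g ∈ gradP r e) {n m : ℤ}
    (hp : p ∈ polyPiece r n) (h : n + e = m) : g * p ∈ polyPiece r m :=
  h ▸ GradedPieces.smul_mem hg hp

/-! ### Radicals and projective points -/

/-- The radical of a homogeneous ideal is the intersection of the homogeneous primes above it. Those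
containing the irrelevant ideal contain `g` because its degree is positive; the others are points of
`ℙ^r`. As `I` need not be homogeneous, the argument runs on the ideal generated by its homogeneous
elements. -/
lemma exists_pow_mem_of_forall_point {I : Ideal (P r)} {e : ℕ} (he : 0 < e) {g : P r}
    (hg : g ∈ gradP r e)
    (h : ∀ x : ProjectiveSpectrum (gradP r), g ∈ compl x →
      ∃ n, ∃ t ∈ gradP r n, t ∈ I ∧ t ∈ compl x) :
    ∃ N : ℕ, g ^ N ∈ I := by
  let I' : Ideal (P r) := Ideal.span {t | t ∈ I ∧ SetLike.IsHomogeneousElem (gradP r) t}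
  have hI' : I'.IsHomogeneous (gradP r) := Ideal.homogeneous_span _ _ fun t ht => ht.2
  have hle : I' ≤ I := Ideal.span_le.2 fun t ht => ht.1
  suffices g ∈ I'.radical by
    obtain ⟨N, hN⟩ := this
    exact ⟨N, hle hN⟩
  rw [hI'.radical_eq, Ideal.mem_sInf]
  rintro Q ⟨hQ, hIQ, hQp⟩
  by_contra hgQ
  have hrel : ¬ HomogeneousIdeal.irrelevant (gradP r) ≤ ⟨Q, hQ⟩ := by
    intro hir
    apply hgQ
    refine hir ?_
    rw [HomogeneousIdeal.mem_irrelevant_iff, GradedRing.proj_apply,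
      DirectSum.decompose_of_mem_ne (gradP r) hg he.ne']
  obtain ⟨n, t, ht, htI, htx⟩ := h ⟨⟨Q, hQ⟩, hQp, hrel⟩ hgQ
  exact htx (hIQ (Ideal.subset_span ⟨htI, n, ht⟩))

lemma exists_homogeneous_notMem (x : ProjectiveSpectrum (gradP r)) {p : P r} (hp : p ∈ compl x) :
    ∃ n : ℕ, homogeneousComponent n p ∈ compl x := by
  by_contra hc
  push Not at hc
  refine hp ?_
  rw [← sum_homogeneousComponent p]
  exact Ideal.sum_mem _ fun n _ => not_not.1 (hc n)

lemma exists_X_notMem (x : ProjectiveSpectrum (gradP r)) : ∃ i, (X i : P r) ∈ compl x := by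
  by_contra hc
  push Not at hc
  apply x.not_irrelevant_le
  intro p hp
  rw [HomogeneousIdeal.mem_irrelevant_iff, GradedRing.proj_apply] at hp
  have h0 : constantCoeff p = 0 := by
    have := decomposition.decompose'_apply p 0
    have h2 : homogeneousComponent 0 p = 0 := this.symm.trans hp
    rw [homogeneousComponent_zero, C_eq_zero] at h2
    exact h2
  have : p ∈ Ideal.span (Set.range (X : Fin (r + 1) → P r)) := by
    rw [← Set.image_univ, mem_ideal_span_X_image]
    intro m hm
    by_contra hcon
    push Not at hcon
    obtain rfl : m = 0 := Finsupp.ext fun i => hcon i trivial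
    exact (mem_support_iff.1 hm) h0
  refine (Ideal.span_le (I := x.asHomogeneousIdeal.toIdeal)).2 ?_ this
  rintro _ ⟨i, rfl⟩
  exact not_not.1 (hc i)

/-- The generic point of projective space. -/
def genericPt (r : ℕ) : ProjectiveSpectrum (gradP r) where
  asHomogeneousIdeal := ⊥
  isPrime := by simpa using Ideal.isPrime_bot
  not_irrelevant_le := by
    intro h
    have : (X 0 : P r) ∈ HomogeneousIdeal.irrelevant (gradP r) := by
      rw [HomogeneousIdeal.mem_irrelevant_iff, GradedRing.proj_apply,
        DirectSum.decompose_of_mem_ne (gradP r) (i := 1) (isHomogeneous_X ℂ 0) one_ne_zero]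
    exact X_ne_zero (R := ℂ) (0 : Fin (r + 1)) (h this)

lemma ne_zero_of_mem_compl {x : ProjectiveSpectrum (gradP r)} {p : P r} (h : p ∈ compl x) :
    p ≠ 0 := by
  rintro rfl
  exact h (Ideal.zero_mem _)

lemma genericPt_mem {U : Opens (ProjSpace r)} {x : ProjSpace r} (hx : x ∈ U) :
    (genericPt r : ProjSpace r) ∈ U := by
  obtain ⟨s, hs⟩ := (ProjectiveSpectrum.isOpen_iff (gradP r) U.1).1 U.2
  by_contra hc
  have h1 : genericPt r ∈ ProjectiveSpectrum.zeroLocus (gradP r) s := hs ▸ hc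
  have h2 : x ∉ ProjectiveSpectrum.zeroLocus (gradP r) s := fun h => (hs ▸ h : x ∈ U.1ᶜ) hx
  refine h2 fun t ht => ?_
  have : t = 0 := h1 ht
  rw [this]
  exact Ideal.zero_mem _

lemma exists_basicOpen_le {U : Opens (ProjSpace r)} {x : ProjSpace r} (hx : x ∈ U) :
    ∃ e : ℕ, 0 < e ∧ ∃ g ∈ gradP r e, g ∈ compl x ∧
      ∀ y : ProjSpace r, g ∈ compl y → y ∈ U := by
  obtain ⟨s, hs⟩ := (ProjectiveSpectrum.isOpen_iff (gradP r) U.1).1 U.2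
  have h2 : x ∉ ProjectiveSpectrum.zeroLocus (gradP r) s := fun h => (hs ▸ h : x ∈ U.1ᶜ) hx
  obtain ⟨t, ht, htx⟩ := Set.not_subset.1 h2
  obtain ⟨n, hn⟩ := exists_homogeneous_notMem x (p := t) htx
  obtain ⟨i, hi⟩ := exists_X_notMem x
  -- The factor `X i`, nonzero at `x`, makes the degree positive even when `n = 0`.
  refine ⟨n + 1, Nat.succ_pos _, homogeneousComponent n t * X i,
    (homogeneousComponent_isHomogeneous n t).mul (isHomogeneous_X ℂ i),
    (compl x).mul_mem hn hi, fun y hy => ?_⟩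
  by_contra hyU
  have h1 : y ∈ ProjectiveSpectrum.zeroLocus (gradP r) s := hs ▸ hyU
  refine hy (Ideal.mul_mem_right _ _ ?_)
  have := y.asHomogeneousIdeal.isHomogeneous n (h1 ht)
  have h3 := decomposition.decompose'_apply t n
  rw [← h3]
  exact this

/-! ### A Čech criterion for the vanishing of the first cohomology group -/

section Cech

open TopCat.Presheaf

variable {X : TopCat.{0}}

lemma restrictOpen_sub {F : TopCat.Presheaf AddCommGrpCat.{0} X} {U V : Opens X} (h : V ≤ U)
    (s t : F.obj (op U)) :
    restrictOpen (s - t) V h = restrictOpen s V h - restrictOpen t V h :=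
  map_sub (F.map (homOfLE h).op).hom s t

/-- Every Čech `1`-cocycle of `F` for the cover `U` is a coboundary. -/
def CechOneVanishes {ι : Type} (F : CategoryTheory.Sheaf (Opens.grothendieckTopology X) AddCommGrpCat.{0})
    (U : ι → Opens X) : Prop :=
  ∀ a : ∀ i j, F.obj.obj (op (U i ⊓ U j)),
    (∀ i j k, ∀ W : Opens X, ∀ (hi : W ≤ U i) (hj : W ≤ U j) (hk : W ≤ U k),
      restrictOpen (a j k) W (le_inf hj hk) - restrictOpen (a i k) W (le_inf hi hk) +
        restrictOpen (a i j) W (le_inf hi hj) = 0) →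
    ∃ c : ∀ i, F.obj.obj (op (U i)), ∀ i j,
      a i j = restrictOpen (c j) (U i ⊓ U j) inf_le_right -
        restrictOpen (c i) (U i ⊓ U j) inf_le_left

lemma app_injective_of_mono {F G : CategoryTheory.Sheaf (Opens.grothendieckTopology X) AddCommGrpCat.{0}}
    (f : F ⟶ G) [Mono f] (U : Opens X) : Function.Injective (f.hom.app (op U)) := by
  have h1 : Mono ((sheafToPresheaf _ _).map f) := inferInstance
  have h2 : Mono (((evaluation _ _).obj (op U)).map ((sheafToPresheaf _ _).map f)) := inferInstance
  exact (AddCommGrpCat.mono_iff_injective _).1 h2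

/-- Local lifts of `q` differ on overlaps by a cocycle with values in the subsheaf. If it is the
coboundary of `c`, the lifts corrected by `c` agree on overlaps and glue. -/
lemma exists_global_lift_of_cechOneVanishes
    {S : ShortComplex (CategoryTheory.Sheaf (Opens.grothendieckTopology X) AddCommGrpCat.{0})}
    (hS : S.ShortExact)
    (hF : ∀ V : X → Opens X, (∀ x, x ∈ V x) → ∃ (ι : Type) (p : ι → X) (U : ι → Opens X),
      (∀ i, U i ≤ V (p i)) ∧ iSup U = ⊤ ∧ CechOneVanishes S.X₁ U)
    (q : S.X₃.obj.obj (op ⊤)) : ∃ t, S.g.hom.app (op ⊤) t = q := by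
  have hmono := hS.mono_f
  have hsurj := (TopCat.Sheaf.isLocallySurjective_iff_epi S.g).mpr hS.epi_g
  have hloc := fun x : X => (isLocallySurjective_iff S.g.hom).mp hsurj ⊤ q x trivial
  choose V hV ht hx using hloc
  choose t ht using ht
  obtain ⟨ι, p, U, hUV, hU, hcech⟩ := hF V hx
  have hu : ∀ i, ∃ u : S.X₂.obj.obj (op (U i)),
      S.g.hom.app (op (U i)) u = restrictOpen q (U i) le_top := fun i =>
    ⟨restrictOpen (t (p i)) (U i) (hUV i), by rw [map_restrict, ht, restrict_restrict]⟩
  choose u hu using hu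
  have hdiff : ∀ i j, ∃ a : S.X₁.obj.obj (op (U i ⊓ U j)), S.f.hom.app (op (U i ⊓ U j)) a =
      restrictOpen (u j) (U i ⊓ U j) inf_le_right -
        restrictOpen (u i) (U i ⊓ U j) inf_le_left := by
    intro i j
    refine TopCat.Sheaf.sections_exact_of_left_exact hS.1 hS.2 _ ?_
    rw [map_sub, map_restrict, map_restrict, hu, hu, restrict_restrict, restrict_restrict, sub_self]
  choose a ha using hdiff
  obtain ⟨c, hc⟩ := hcech a (by
    intro i j k W hi hj hk
    apply app_injective_of_mono S.f W
    rw [map_add, map_sub, map_restrict, map_restrict, map_restrict, ha, ha, ha, map_zero]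
    simp only [restrictOpen_sub, restrict_restrict]
    abel)
  obtain ⟨s, hs, -⟩ := TopCat.Sheaf.existsUnique_gluing S.X₂ U
    (fun i => u i - S.f.hom.app (op (U i)) (c i)) (by
      intro i j
      change restrictOpen _ (U i ⊓ U j) inf_le_left = restrictOpen _ (U i ⊓ U j) inf_le_right
      have h1 := ha i j
      rw [hc i j, map_sub, map_restrict, map_restrict] at h1
      rw [restrictOpen_sub, restrictOpen_sub]
      rw [sub_eq_sub_iff_add_eq_add] at h1 ⊢
      rw [add_comm _ (restrictOpen (S.f.hom.app _ (c j)) _ _), h1, add_comm])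
  have hgs : S.g.hom.app (op (iSup U)) s = restrictOpen q (iSup U) le_top := by
    refine TopCat.Sheaf.eq_app_of_locally_eq hs (fun _ => le_top) fun i => ?_
    have h0 : S.g.hom.app (op (U i)) (S.f.hom.app (op (U i)) (c i)) = 0 := by
      rw [← CategoryTheory.comp_apply, ← NatTrans.comp_app,
        ← ObjectProperty.FullSubcategory.comp_hom, S.zero]
      rfl
    rw [map_sub, h0, sub_zero, hu]
    rfl
  refine ⟨restrictOpen s ⊤ hU.ge, ?_⟩
  rw [map_restrict, hgs, restrict_restrict]
  change S.X₃.obj.map (𝟙 _) q = q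
  rw [S.X₃.obj.map_id]
  rfl

/-- The first cohomology group of `F` vanishes if arbitrarily fine open covers have no Čech
cohomology in degree `1` with values in `F`. -/
lemma subsingleton_H_one_of_cechOneVanishes
    (F : CategoryTheory.Sheaf (Opens.grothendieckTopology X) AddCommGrpCat.{0})
    (hF : ∀ V : X → Opens X, (∀ x, x ∈ V x) → ∃ (ι : Type) (p : ι → X) (U : ι → Opens X),
      (∀ i, U i ≤ V (p i)) ∧ iSup U = ⊤ ∧ CechOneVanishes F U) :
    Subsingleton (Sheaf.H F 1) := by
  refine subsingleton_of_forall_eq 0 fun x => ?_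
  let S : ShortComplex (CategoryTheory.Sheaf (Opens.grothendieckTopology X) AddCommGrpCat.{0}) :=
    ShortComplex.mk (Injective.ι F) (Limits.cokernel.π (Injective.ι F))
      (Limits.cokernel.condition _)
  have hS : S.ShortExact :=
    { exact := ShortComplex.exact_cokernel _
      mono_f := inferInstanceAs (Mono (Injective.ι F))
      epi_g := inferInstanceAs (Epi (Limits.cokernel.π _)) }
  -- Every class dies in the injective sheaf, hence comes from a global section of the quotient.
  -- Lifting that section to the injective sheaf shows that the class is zero.
  obtain ⟨q, rfl⟩ := Abelian.Ext.covariant_sequence_exact₁ _ hS x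
    (Abelian.Ext.eq_zero_of_injective (I := Injective.under F) (n := 0) _) (zero_add 1)
  obtain ⟨t, ht⟩ := exists_global_lift_of_cechOneVanishes hS hF
    (Sheaf.H.equiv₀ S.X₃ Limits.isTerminalTop q)
  have hq : q = Sheaf.H.map S.g 0 ((Sheaf.H.equiv₀ S.X₂ Limits.isTerminalTop).symm t) := by
    rw [Sheaf.H.equiv₀_symm_naturality]
    apply (Sheaf.H.equiv₀ S.X₃ Limits.isTerminalTop).injective
    rw [AddEquiv.apply_symm_apply]
    exact ht.symm
  rw [hq, Sheaf.H.map_apply, Abelian.Ext.comp_assoc_of_second_deg_zero, hS.comp_extClass,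
    Abelian.Ext.comp_zero]

end Cech

/-! ### Sections of the sheaves `𝒪(k)` -/

lemma mk_eq_mk_iff {x : ProjectiveSpectrum (gradP r)} {m m' : P r} {s s' : compl x} :
    (LocalizedModule.mk m s : LocalizedModule (compl x) (P r)) = LocalizedModule.mk m' s' ↔
      (s' : P r) * m = s * m' := by
  rw [LocalizedModule.mk_eq]
  constructor
  · rintro ⟨u, hu⟩
    exact mul_left_cancel₀ (ne_zero_of_mem_compl u.2) hu
  · intro h
    exact ⟨1, congrArg _ h⟩

lemma mk_eq_mk_iff' {U : Opens (ProjSpace r)} {x : U} {m m' : P r} {s s' : compl x.1} :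
    (LocalizedModule.mk m s : LocalizedModule (compl x.1) (P r)) = LocalizedModule.mk m' s' ↔
      (s' : P r) * m = s * m' :=
  mk_eq_mk_iff

lemma pow_mem_gradP {e : ℕ} {g : P r} (hg : g ∈ gradP r e) (N : ℕ) : g ^ N ∈ gradP r (N * e) := by
  simpa using SetLike.pow_mem_graded N hg

/-- The germ at the generic point of a section. -/
def genericGerm {k : ℤ} {U : Opens (ProjSpace r)} (f : sections (polyPiece r) k U)
    (h : (genericPt r : ProjSpace r) ∈ U) : LocalizedModule (compl (genericPt r)) (P r) :=
  f.1 ⟨genericPt r, h⟩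

/-- A neighbourhood of `x` contains the generic point, so one fraction represents the germ at both.
Since `P r` is a domain, identities between germs can then be checked at the generic point. -/
lemma exists_rep {k : ℤ} {U : Opens (ProjSpace r)} (f : sections (polyPiece r) k U) (x : U) :
    ∃ (i : ℕ) (m s : P r) (_ : m ∈ polyPiece r (k + i)) (_ : s ∈ gradP r i)
      (hs : s ∈ compl x.1), f.1 x = LocalizedModule.mk m ⟨s, hs⟩ ∧
        genericGerm f (genericPt_mem x.2) =
          LocalizedModule.mk m ⟨s, ne_zero_of_mem_compl hs⟩ := by
  obtain ⟨V, hV, ι, i, m, s, hm, hs, hx, h⟩ := f.2 x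
  exact ⟨i, m, s, hm, hs, hx ⟨x.1, hV⟩, h ⟨x.1, hV⟩, h ⟨genericPt r, genericPt_mem hV⟩⟩

lemma smul_germ_eq_iff {k : ℤ} {U : Opens (ProjSpace r)} (f : sections (polyPiece r) k U) (x : U)
    (t p : P r) : t • f.1 x = LocalizedModule.mk p 1 ↔
      t • genericGerm f (genericPt_mem x.2) = LocalizedModule.mk p 1 := by
  obtain ⟨i, m, s, -, -, hs, h1, h2⟩ := exists_rep f x
  rw [h1, h2, LocalizedModule.smul'_mk, LocalizedModule.smul'_mk, mk_eq_mk_iff', mk_eq_mk_iff]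
  rfl

/-- On a section of `𝒪(k)` over `U`, denominators may be cleared by a power of any homogeneous
polynomial which vanishes outside `U`. -/
lemma exists_pow_smul_section {k : ℤ} {U : Opens (ProjSpace r)} (f : sections (polyPiece r) k U)
    {e : ℕ} (he : 0 < e) {g : P r} (hg : g ∈ gradP r e)
    (hU : ∀ x : ProjSpace r, g ∈ compl x → x ∈ U) :
    ∃ N : ℕ, ∃ p ∈ polyPiece r (k + (N * e : ℕ)),
      ∀ x : U, g ^ N • f.1 x = LocalizedModule.mk p 1 := by
  -- The ideal of denominators of `f`. A denominator of `f` near one point lies in it, because the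
  -- identity it satisfies there passes through the generic point to all of `U`.
  let I : Ideal (P r) :=
    { carrier := {t | ∃ p, ∀ x : U, t • f.1 x = LocalizedModule.mk p 1}
      zero_mem' := ⟨0, fun x => by rw [zero_smul, LocalizedModule.zero_mk]⟩
      add_mem' := by
        rintro t t' ⟨p, hp⟩ ⟨p', hp'⟩
        refine ⟨p + p', fun x => ?_⟩
        rw [add_smul, hp, hp', LocalizedModule.mk_add_mk]
        simp
      smul_mem' := by
        rintro c t ⟨p, hp⟩
        refine ⟨c • p, fun x => ?_⟩
        rw [smul_eq_mul, mul_smul, hp, LocalizedModule.smul'_mk] }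
  obtain ⟨N, p, hp⟩ := exists_pow_mem_of_forall_point (I := I) he hg (by
    intro x hx
    obtain ⟨i, m, s, hm, hs, hsx, h1, h2⟩ := exists_rep f ⟨x, hU x hx⟩
    refine ⟨i, s, hs, ⟨m, fun y => ?_⟩, hsx⟩
    rw [smul_germ_eq_iff, h2, LocalizedModule.smul'_mk, mk_eq_mk_iff]
    exact one_mul _)
  -- Comparing components of the right degree in `s * p = g ^ N * m` lets `p` be replaced by a
  -- homogeneous polynomial.
  refine ⟨N, polyProj r (k + (N * e : ℕ)) p, polyProj_mem _ _, fun x => ?_⟩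
  have hpx := hp x
  obtain ⟨i, m, s, hm, hs, hsx, h1, -⟩ := exists_rep f x
  rw [h1, LocalizedModule.smul'_mk, mk_eq_mk_iff'] at hpx ⊢
  rw [OneMemClass.coe_one, one_mul, smul_eq_mul] at hpx ⊢
  rw [← polyProj_mul hs, ← hpx, polyProj_of_mem]
  exact mul_mem_polyPiece (pow_mem_gradP hg N) hm (by ring)

lemma ext_of_genericGerm {k : ℤ} {U : Opens (ProjSpace r)} {f f' : sections (polyPiece r) k U}
    (h : ∀ hU : (genericPt r : ProjSpace r) ∈ U, genericGerm f hU = genericGerm f' hU) : f = f' := by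
  refine Subtype.ext (funext fun x => ?_)
  obtain ⟨i, m, s, -, -, hs, h1, h2⟩ := exists_rep f x
  obtain ⟨i', m', s', -, -, hs', h1', h2'⟩ := exists_rep f' x
  have := h (genericPt_mem x.2)
  rw [h2, h2', mk_eq_mk_iff] at this
  rw [h1, h1', mk_eq_mk_iff']
  exact this

lemma germ_eq_mk_iff {k : ℤ} {U : Opens (ProjSpace r)} (f : sections (polyPiece r) k U) (x : U)
    (t p : P r) (ht : t ∈ compl x.1) : f.1 x = LocalizedModule.mk p ⟨t, ht⟩ ↔
      t • f.1 x = LocalizedModule.mk p 1 := by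
  obtain ⟨i, m, s, -, -, hs, h1, h2⟩ := exists_rep f x
  rw [h1, LocalizedModule.smul'_mk, mk_eq_mk_iff', mk_eq_mk_iff']
  simp

/-- The global sections of `𝒪(k)` are the homogeneous polynomials of degree `k`. -/
lemma exists_eq_of_global_section (hr : 1 ≤ r) {k : ℤ} (f : sections (polyPiece r) k ⊤) :
    ∃ a ∈ polyPiece r k, ∀ x : (⊤ : Opens (ProjSpace r)), f.1 x = LocalizedModule.mk a 1 := by
  have hX : ∀ i : Fin (r + 1), ∃ N : ℕ, ∃ p : P r,
      ∀ x : (⊤ : Opens (ProjSpace r)), (X i : P r) ^ N • f.1 x = LocalizedModule.mk p 1 := by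
    intro i
    obtain ⟨N, p, -, h⟩ := exists_pow_smul_section f one_pos (isHomogeneous_X ℂ i)
      (fun _ _ => trivial)
    exact ⟨N, p, h⟩
  let l : Fin (r + 1) := Fin.last r
  have hl : (0 : Fin (r + 1)) ≠ l := by
    intro h; have := congrArg Fin.val h; simp [l] at this; omega
  obtain ⟨N, p, hp⟩ := hX 0
  obtain ⟨M, q, hq⟩ := hX l
  let η : (⊤ : Opens (ProjSpace r)) := ⟨genericPt r, trivial⟩
  obtain ⟨i, m, s, hm, hs, hsx, h1, -⟩ := exists_rep f η
  have hp' := hp η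
  have hq' := hq η
  have hs0 := ne_zero_of_mem_compl hsx
  rw [h1, LocalizedModule.smul'_mk, mk_eq_mk_iff] at hp' hq'
  rw [OneMemClass.coe_one, one_mul, smul_eq_mul] at hp' hq'
  -- The section is both `p / X₀^N` and `q / X_l^M`, so `X₀^N` divides `X_l^M * p`, and `X₀` is a
  -- prime not dividing `X_l`.
  have hdvd : (X 0 : P r) ^ N ∣ p := by
    have hd : (X 0 : P r) ^ N ∣ X l ^ M * p := by
      refine ⟨q, mul_left_cancel₀ hs0 ?_⟩
      linear_combination (-(X l) ^ M) * hp' + X 0 ^ N * hq'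
    have hprime : Prime (X 0 : P r) := X_prime
    refine hprime.pow_dvd_of_dvd_mul_left N (fun hc => hl ?_) hd
    have := hprime.dvd_of_dvd_pow hc
    exact X_dvd_X.1 this
  obtain ⟨a, rfl⟩ := hdvd
  have ha : m = s * a := by
    refine mul_left_cancel₀ (pow_ne_zero N (X_ne_zero (R := ℂ) (0 : Fin (r + 1)))) ?_
    rw [hp']; ring
  have hgen : ∀ x : (⊤ : Opens (ProjSpace r)), ∀ b : P r, m = s * b →
      f.1 x = LocalizedModule.mk b 1 := by
    intro x b hb
    have := (smul_germ_eq_iff f x 1 b).2 (by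
      rw [one_smul]
      refine h1.trans ?_
      rw [mk_eq_mk_iff, OneMemClass.coe_one, one_mul]
      exact hb)
    rwa [one_smul] at this
  refine ⟨polyProj r k a, polyProj_mem _ _, fun x => hgen x _ ?_⟩
  rw [← polyProj_mul hs, ← ha, polyProj_of_mem hm]

/-- The section `p / t` of `𝒪(k)` over an open set on which `t` has no zeros. -/
def fracSection {k : ℤ} (U : Opens (ProjSpace r)) {e : ℕ} {t p : P r} (ht : t ∈ gradP r e)
    (hp : p ∈ polyPiece r (k + e)) (hU : ∀ x : U, t ∈ compl x.1) : sections (polyPiece r) k U :=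
  ⟨fun x => LocalizedModule.mk p ⟨t, hU x⟩,
    fun x => ⟨U, x.2, 𝟙 U, e, p, t, hp, ht, hU, fun _ => rfl⟩⟩

/-! ### Vanishing of `H¹(𝒪(k))` -/

lemma exists_X_pow_mem {I : Ideal (P r)}
    (h : ∀ x : ProjectiveSpectrum (gradP r), ∃ n, ∃ t ∈ gradP r n, t ∈ I ∧ t ∈ compl x) :
    ∃ N : ℕ, ∀ i : Fin (r + 1), (X i : P r) ^ N ∈ I := by
  have hX : ∀ i : Fin (r + 1), ∃ N : ℕ, (X i : P r) ^ N ∈ I := fun i =>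
    exists_pow_mem_of_forall_point one_pos (isHomogeneous_X ℂ i) fun x _ => h x
  choose N hN using hX
  exact ⟨Finset.univ.sup N, fun i =>
    I.pow_mem_of_pow_mem (hN i) (Finset.le_sup (f := N) (Finset.mem_univ i))⟩

/-- The `g i` have no common zero in `ℙ^r`, so their ideal contains a power of every variable. As `r
≥ 2`, there are three variables to form the regular sequence. -/
lemma exists_koszul_primitive_of_cover (hr : 2 ≤ r) {ι : Type} [Fintype ι] {g : ι → P r}
    {e : ι → ℕ} (hg : ∀ i, g i ∈ gradP r (e i))
    (hcov : ∀ x : ProjectiveSpectrum (gradP r), ∃ i, g i ∈ compl x) (b : ι → ι → P r)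
    (hb : ∀ i j k, g i * b j k - g j * b i k + g k * b i j = 0) :
    ∃ c : ι → P r, ∀ i j, b i j = g j * c i - g i * c j := by
  obtain ⟨N, hN⟩ := exists_X_pow_mem (I := Ideal.span (Set.range g)) fun x => by
    obtain ⟨i, hi⟩ := hcov x
    exact ⟨e i, g i, hg i, Ideal.subset_span ⟨i, rfl⟩, hi⟩
  let v : Fin 3 → Fin (r + 1) := Fin.castLE (by omega)
  have hv : Function.Injective v := Fin.castLE_injective _
  refine exists_koszul_primitive g b hb (X (v 0) ^ N) (X (v 1) ^ N) (X (v 2) ^ N)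
    (hN _) (hN _) (hN _) ?_ ?_ ?_
  · intro a ha
    exact (mul_eq_zero.1 ha).resolve_left (pow_ne_zero _ (X_ne_zero _))
  · intro a ha
    have := X_pow_mul_mem_span (S := {v 0}) (k := v 1)
      (by rw [Set.mem_singleton_iff, hv.eq_iff]; decide) N (e := a)
    rw [Set.image_singleton] at this
    exact this ha
  · intro a ha
    have := X_pow_mul_mem_span (S := {v 0, v 1}) (k := v 2)
      (by rw [Set.mem_insert_iff, Set.mem_singleton_iff, hv.eq_iff, hv.eq_iff]; decide) N (e := a)
    rw [Set.image_pair] at this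
    exact this ha

/-- With a common exponent, `a i j = b i j / (G i * G j)`, and the cocycle condition becomes the
Koszul relation for `b`. A primitive `c` gives `a i j = c i / G i - c j / G j`, whence the sign in
the splitting `-c i / G i`. -/
lemma cechOneVanishes_basicOpen (hr : 2 ≤ r) {ι : Type} [Fintype ι] {g : ι → P r} {e : ι → ℕ}
    (he : ∀ i, 0 < e i) (hg : ∀ i, g i ∈ gradP r (e i)) (hg0 : ∀ i, g i ≠ 0)
    (hcov : ∀ x : ProjectiveSpectrum (gradP r), ∃ i, g i ∈ compl x) (k : ℤ) :
    CechOneVanishes (X := ProjSpace r) (assoc (polyPiece r) k)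
      (fun i => ProjectiveSpectrum.basicOpen (gradP r) (g i)) := by
  intro a ha
  let U : ι → Opens (ProjSpace r) := fun i => ProjectiveSpectrum.basicOpen (gradP r) (g i)
  have hη : ∀ i, (genericPt r : ProjSpace r) ∈ U i := fun i => hg0 i
  let a' : ∀ i j, sections (polyPiece r) k (U i ⊓ U j) := a
  have hη2 : ∀ i j, (genericPt r : ProjSpace r) ∈ U i ⊓ U j := fun i j => ⟨hη i, hη j⟩
  have h1 : ∀ i j, ∃ N : ℕ, ∃ p ∈ polyPiece r (k + (N * (e i + e j) : ℕ)),
      ∀ x : (U i ⊓ U j : Opens (ProjSpace r)),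
        (g i * g j) ^ N • (a' i j).1 x = LocalizedModule.mk p 1 := fun i j =>
    exists_pow_smul_section (a' i j) (Nat.add_pos_left (he i) _)
      (SetLike.mul_mem_graded (hg i) (hg j)) fun x hx =>
        ⟨fun h => hx (Ideal.mul_mem_right _ _ h), fun h => hx (Ideal.mul_mem_left _ _ h)⟩
  choose M p hp hMp using h1
  let N : ℕ := Finset.univ.sup fun q : ι × ι => M q.1 q.2
  have hMN : ∀ i j, M i j ≤ N := fun i j =>
    Finset.le_sup (f := fun q : ι × ι => M q.1 q.2) (Finset.mem_univ (i, j))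
  let G : ι → P r := fun i => g i ^ N
  have hG : ∀ i, G i ∈ gradP r (N * e i) := fun i => pow_mem_gradP (hg i) N
  let b : ι → ι → P r := fun i j => (g i * g j) ^ (N - M i j) * p i j
  have hbdeg : ∀ i j, b i j ∈ polyPiece r (k + (N * e i : ℕ) + (N * e j : ℕ)) := by
    intro i j
    refine mul_mem_polyPiece (pow_mem_gradP (SetLike.mul_mem_graded (hg i) (hg j)) _) (hp i j) ?_
    have := hMN i j
    push_cast [Nat.cast_sub this]
    ring
  have hba : ∀ i j, ∀ x : (U i ⊓ U j : Opens (ProjSpace r)),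
      (G i * G j) • (a' i j).1 x = LocalizedModule.mk (b i j) 1 := by
    intro i j x
    have hGG : G i * G j = (g i * g j) ^ (N - M i j) * (g i * g j) ^ M i j := by
      rw [← pow_add, Nat.sub_add_cancel (hMN i j), mul_pow]
    rw [hGG, mul_smul, hMp, LocalizedModule.smul'_mk, smul_eq_mul]
  have hgen : ∀ i j, (G i * G j) • genericGerm (a' i j) (hη2 i j) =
      LocalizedModule.mkLinearMap (compl (genericPt r)) (P r) (b i j) := fun i j =>
    hba i j ⟨_, hη2 i j⟩
  have hcoc : ∀ i j l, genericGerm (a' j l) (hη2 j l) - genericGerm (a' i l) (hη2 i l) +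
      genericGerm (a' i j) (hη2 i j) = 0 := by
    intro i j l
    have := ha i j l (U i ⊓ U j ⊓ U l) (inf_le_left.trans inf_le_left)
      (inf_le_left.trans inf_le_right) inf_le_right
    exact congrFun (congrArg Subtype.val this) ⟨genericPt r, ⟨hη i, hη j⟩, hη l⟩
  obtain ⟨c, hc⟩ := exists_koszul_primitive_of_cover hr hG (fun x => by
      obtain ⟨i, hi⟩ := hcov x
      exact ⟨i, Submonoid.pow_mem _ hi N⟩) b (by
    intro i j l
    have hz : LocalizedModule.mkLinearMap (compl (genericPt r)) (P r)
        (G i * b j l - G j * b i l + G l * b i j) = 0 := by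
      simp only [← smul_eq_mul, map_add, map_sub, map_smul, ← hgen]
      simp only [smul_eq_mul, smul_smul]
      rw [show G j * (G i * G l) = G i * (G j * G l) by ring,
        show G l * (G i * G j) = G i * (G j * G l) by ring, ← smul_sub, ← smul_add, hcoc, smul_zero]
    rw [LocalizedModule.mkLinearMap_apply, ← LocalizedModule.zero_mk 1, mk_eq_mk_iff] at hz
    simpa using hz)
  -- The primitive need not be homogeneous, but `b` and `G` are, so the components of the right
  -- degree form a primitive too.
  let c' : ι → P r := fun i => polyProj r (k + (N * e i : ℕ)) (c i)
  have hc' : ∀ i j, b i j = G j * c' i - G i * c' j := by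
    intro i j
    rw [← polyProj_of_mem (hbdeg i j), hc, map_sub, polyProj_mul (hG j), add_right_comm,
      polyProj_mul (hG i)]
  refine ⟨fun i => fracSection (U i) (hG i) (p := -c' i)
    ((polyPiece r _).neg_mem (polyProj_mem _ _)) fun x => Submonoid.pow_mem _ x.2 N, fun i j => ?_⟩
  refine ext_of_genericGerm (f := a' i j) fun hU => ?_
  have h2 := (germ_eq_mk_iff (a' i j) ⟨genericPt r, hU⟩ (G i * G j) (b i j)
    (Submonoid.mul_mem _ (pow_ne_zero N (hg0 i)) (pow_ne_zero N (hg0 j)))).2 (hba i j _)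
  refine h2.trans ?_
  change _ = (LocalizedModule.mk (-c' j) ⟨G j, _⟩ - LocalizedModule.mk (-c' i) ⟨G i, _⟩ :
    LocalizedModule (compl (genericPt r)) (P r))
  rw [sub_eq_add_neg, ← LocalizedModule.mk_neg, LocalizedModule.mk_add_mk, mk_eq_mk_iff]
  simp only [Submonoid.smul_def, Submonoid.coe_mul, smul_eq_mul, hc' i j]
  ring

lemma subsingleton_H_one_structureSheaf (hr : 2 ≤ r) (k : ℤ) :
    Subsingleton (Sheaf.H (assoc (polyPiece r) k : AbSheaf r) 1) := by
  refine subsingleton_H_one_of_cechOneVanishes _ fun V hV => ?_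
  choose e he g hg hgx hgV using fun x => exists_basicOpen_le (hV x)
  obtain ⟨N, hN⟩ := exists_X_pow_mem (I := Ideal.span (Set.range g)) fun x =>
    ⟨e x, g x, hg x, Ideal.subset_span ⟨x, rfl⟩, hgx x⟩
  -- Quasi-compactness: finitely many `g x` already generate an ideal containing the chosen powers
  -- of the variables. Finiteness is what allows a common exponent for the denominators.
  have hfin : ∃ T : Finset (ProjSpace r), ∀ i : Fin (r + 1),
      (X i : P r) ^ N ∈ Ideal.span (g '' T) := by
    classical
    have h1 : ∀ i : Fin (r + 1), ∃ T : Finset (ProjSpace r),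
        (X i : P r) ^ N ∈ Ideal.span (g '' T) := by
      intro i
      obtain ⟨T, hT, hmem⟩ := Submodule.mem_span_finite_of_mem_span (hN i)
      obtain ⟨T', hT'⟩ := Finset.subset_set_image_iff.1 (Set.image_univ (f := g) ▸ hT)
      refine ⟨T', ?_⟩
      rw [← Finset.coe_image, hT'.2]
      exact hmem
    choose T hT using h1
    refine ⟨Finset.univ.biUnion T, fun i => ?_⟩
    refine Ideal.span_mono (Set.image_mono ?_) (hT i)
    exact_mod_cast Finset.subset_biUnion_of_mem T (Finset.mem_univ i)
  obtain ⟨T, hT⟩ := hfin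
  have hcov : ∀ x : ProjectiveSpectrum (gradP r), ∃ t : T, g t ∈ compl x := by
    intro x
    by_contra hc
    push Not at hc
    obtain ⟨i, hi⟩ := exists_X_notMem x
    refine Submonoid.pow_mem _ hi N ((Ideal.span_le (I := x.asHomogeneousIdeal.toIdeal)).2 ?_ (hT i))
    rintro _ ⟨t, ht, rfl⟩
    exact not_not.1 (hc ⟨t, ht⟩)
  refine ⟨T, Subtype.val, fun t => ProjectiveSpectrum.basicOpen (gradP r) (g t),
    fun t y hy => hgV _ y hy, ?_, ?_⟩
  · refine top_le_iff.1 fun x _ => ?_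
    obtain ⟨t, ht⟩ := hcov x
    exact Opens.mem_iSup.2 ⟨t, ht⟩
  · exact cechOneVanishes_basicOpen hr (fun t : T => he t) (fun t => hg t)
      (fun t => ne_zero_of_mem_compl (hgx t)) hcov k

/-- The sheaf `𝒪(1)^{r+1}(k)` of vector fields on affine space. -/
abbrev fieldSheaf (r : ℕ) (k : ℤ) : AbSheaf r := assoc (fieldPiece r) k

/-- The coefficient of `∂/∂Xᵢ`. -/
def fieldCoeff (k : ℤ) (i : Fin (r + 1)) :
    fieldSheaf r k ⟶ (assoc (polyPiece r) (k + 1) : AbSheaf r) :=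
  assocMap (LinearMap.proj i) k (k + 1) fun j m hm => by
    have := hm i
    rwa [add_right_comm] at this

/-- The vector fields `A ∂/∂Xᵢ`. -/
def fieldSingle (k : ℤ) (i : Fin (r + 1)) :
    (assoc (polyPiece r) (k + 1) : AbSheaf r) ⟶ fieldSheaf r k :=
  assocMap (LinearMap.single (P r) (fun _ => P r) i) (k + 1) k fun j m hm l => by
    rw [LinearMap.single_apply]
    rcases eq_or_ne l i with rfl | h
    · rw [Pi.single_eq_same, add_right_comm]; exact hm
    · rw [Pi.single_eq_of_ne h]; exact AddSubgroup.zero_mem _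

/-- Writes the identity as a sum of maps factoring through `𝒪(k + 1)`; by additivity of cohomology,
the vanishing of `H¹` passes to `𝒪(1)^{r+1}(k)`. -/
lemma sum_fieldCoeff_comp_fieldSingle (k : ℤ) :
    ∑ i, fieldCoeff (r := r) k i ≫ fieldSingle k i = 𝟙 _ := by
  have happ : ∀ (U : Opens (ProjSpace r)) (s : Finset (Fin (r + 1)))
      (t : sections (fieldPiece r) k U) (x : U),
      (((∑ i ∈ s, fieldCoeff (r := r) k i ≫ fieldSingle k i).hom.app (op U) t :
        sections (fieldPiece r) k U)).1 x = ∑ i ∈ s,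
        LocalizedModule.map (compl x.1) (LinearMap.single (P r) (fun _ => P r) i)
          (LocalizedModule.map (compl x.1) (LinearMap.proj i) (t.1 x)) := by
    intro U s t x
    classical
    induction s using Finset.induction_on with
    | empty => rfl
    | insert i s hi ih =>
      rw [Finset.sum_insert hi, Finset.sum_insert hi, ← ih]
      rfl
  ext U t
  refine Subtype.ext (funext fun x => ?_)
  refine (happ U.unop Finset.univ t x).trans ?_
  change _ = t.1 x
  induction t.1 x using LocalizedModule.induction_on with
  | h m s =>
    simp only [LocalizedModule.map_mk]
    have : ∀ u : Finset (Fin (r + 1)), ∑ i ∈ u, (LocalizedModule.mk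
        (LinearMap.single (P r) (fun _ => P r) i (LinearMap.proj (R := P r) i m)) s :
          LocalizedModule (compl x.1) (Fin (r + 1) → P r)) =
        LocalizedModule.mk (∑ i ∈ u, LinearMap.single (P r) (fun _ => P r) i
          (LinearMap.proj (R := P r) i m)) s := by
      intro u
      classical
      induction u using Finset.induction_on with
      | empty => simp
      | insert i u hi ih =>
        rw [Finset.sum_insert hi, Finset.sum_insert hi, ih, LocalizedModule.mk_add_mk, ← smul_add,
          LocalizedModule.mk_cancel_common_left]
    rw [this]
    congr 1
    exact LinearMap.sum_single_apply _ m

lemma subsingleton_H_one_fieldSheaf (hr : 2 ≤ r) (k : ℤ) :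
    Subsingleton (Sheaf.H (fieldSheaf r k) 1) := by
  refine subsingleton_of_forall_eq 0 fun x => ?_
  have := subsingleton_H_one_structureSheaf hr (k + 1)
  have h1 : ∀ s : Finset (Fin (r + 1)),
      Sheaf.H.map (∑ i ∈ s, fieldCoeff (r := r) k i ≫ fieldSingle k i) 1 x = 0 := by
    intro s
    classical
    induction s using Finset.induction_on with
    | empty => rw [Finset.sum_empty, Sheaf.H.map_apply, Abelian.Ext.mk₀_zero, Abelian.Ext.comp_zero]
    | insert i s hi ih =>
      rw [Finset.sum_insert hi, Sheaf.H.map_add_apply, ih, Sheaf.H.map_comp_apply,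
        Subsingleton.elim (Sheaf.H.map (fieldCoeff k i) 1 x) 0, map_zero, add_zero]
  have h2 := h1 Finset.univ
  rwa [sum_fieldCoeff_comp_fieldSingle, Sheaf.H.map_id_apply] at h2

/-! ### The sheaf associated with the gradient ideal -/

section AssocMap

variable {M N L : Type} [AddCommGroup M] [Module (P r) M] [AddCommGroup N] [Module (P r) N]
  [AddCommGroup L] [Module (P r) L]

lemma localizedMap_comp {S : Submonoid (P r)} (φ : M →ₗ[P r] N) (ψ : N →ₗ[P r] L)
    (z : LocalizedModule S M) :
    LocalizedModule.map S ψ (LocalizedModule.map S φ z) = LocalizedModule.map S (ψ ∘ₗ φ) z := by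
  induction z using LocalizedModule.induction_on with
  | h m s => simp only [LocalizedModule.map_mk, LinearMap.comp_apply]

lemma localizedMk_eq_zero_iff {S : Submonoid (P r)} {m : M} {s : S} :
    (LocalizedModule.mk m s : LocalizedModule S M) = 0 ↔ ∃ u ∈ S, u • m = 0 := by
  rw [← LocalizedModule.zero_mk 1, LocalizedModule.mk_eq]
  constructor
  · rintro ⟨u, hu⟩
    rw [smul_zero, smul_zero, one_smul] at hu
    exact ⟨u, u.2, hu⟩
  · rintro ⟨u, hu, h⟩
    refine ⟨⟨u, hu⟩, ?_⟩
    rw [smul_zero, smul_zero, one_smul]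
    exact h

end AssocMap

/-- The homogeneous pieces of the gradient ideal. -/
abbrev gradientPiece (f : P r) : ℤ → AddSubgroup (gradientIdeal f) :=
  subPiece (polyPiece r) (gradientIdeal f : Submodule (P r) (P r))

/-- The twists of the ideal sheaf on `ℙ^r` associated with the gradient ideal. -/
abbrev gradientSheaf (f : P r) (k : ℤ) : AbSheaf r := assoc (gradientPiece f) k

/-- `∑ Aᵢ ∂/∂Xᵢ ↦ ∑ Aᵢ ∂f/∂Xᵢ` as a map to the gradient ideal. -/
def gradLin (f : P r) : (Fin (r + 1) → P r) →ₗ[P r] gradientIdeal f :=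
  LinearMap.codRestrict (gradientIdeal f : Submodule (P r) (P r)) (gradPairing f) (gradPairing_mem f)

/-- The projection of the gradient ideal onto its image in the coordinate ring. -/
def gradientProj (f : P r) : gradientIdeal f →ₗ[P r] jacobianModule f :=
  LinearMap.submoduleMap (Submodule.mkQ (Ideal.span {f} : Submodule (P r) (P r))) (gradientIdeal f)

variable {d : ℕ} {f : P r}

/-- The morphism `𝒪(1)^{r+1}(k - d) ⟶ J(f)^~(k)`. -/
def gradPairingSheaf (hf : f.IsHomogeneous d) (k : ℤ) :
    fieldSheaf r (k - d) ⟶ gradientSheaf f k :=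
  assocMap (gradLin f) (k - d) k fun i A hA => by
    have := gradPairing_deg hf _ hA
    rw [show k - d + i + d = k + i by ring] at this
    exact this

/-- The projection `J(f)^~(k) ⟶ 𝒥_{f/X}(k)`. -/
def gradientToJacobian (f : P r) (k : ℤ) : gradientSheaf f k ⟶ jacobianSheafX f k :=
  assocMap (gradientProj f) k k fun _ m hm => ⟨m.1, hm, rfl⟩

/-- The projection `𝒪(1)^{r+1}(k) ⟶ T_{ℙ^r}(k)` of the Euler sequence. -/
def fieldToTangent (k : ℤ) : fieldSheaf r k ⟶ tangentSheaf r k :=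
  assocMap (Submodule.mkQ (eulerSpan r)) k k fun _ m hm => ⟨m, hm, rfl⟩

lemma gradPairingSheaf_comp (hf : f.IsHomogeneous d) (k : ℤ) :
    gradPairingSheaf hf k ≫ gradientToJacobian f k = fieldToTangent (k - d) ≫ eta hf k := by
  ext U t
  exact Subtype.ext (funext fun x =>
    (localizedMap_comp (gradLin f) (gradientProj f) _).trans
      (localizedMap_comp (Submodule.mkQ (eulerSpan r)) (etaLin hf) _).symm)

lemma polyProj_mul_of_mem {q : ℤ} {p : P r} (hp : p ∈ polyPiece r q) (n : ℕ) (u : P r) :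
    polyProj r (n + q) (u * p) = homogeneousComponent n u * p := by
  rcases hp with rfl | ⟨m, rfl, h⟩
  · simp
  · rw [mul_comm, polyProj_mul h, polyProj_natCast, mul_comm]

lemma pderiv_mem_gradP (hf : f.IsHomogeneous d) (i : Fin (r + 1)) :
    pderiv i f ∈ gradP r (d - 1) := hf.pderiv

/-- The partial derivatives are homogeneous of degree `d - 1`, so the coefficients in a relation for
`a` may be replaced by their components of degree `l + 1`. Here `1 ≤ d` keeps the subtraction
honest. -/
lemma exists_field_of_mem_gradientIdeal (hd : 1 ≤ d) (hf : f.IsHomogeneous d) {n l : ℤ}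
    (hnl : l + d = n) {a : P r} (ha : a ∈ polyPiece r n) (haJ : a ∈ gradientIdeal f) :
    ∃ B ∈ fieldPiece r l, gradPairing f B = a := by
  obtain ⟨c, hc⟩ := (Ideal.mem_span_range_iff_exists_fun).1 haJ
  refine ⟨fun i => polyProj r (l + 1) (c i), fun i => polyProj_mem _ _, ?_⟩
  rw [gradPairing_apply, ← polyProj_of_mem ha, ← hc, map_sum]
  refine Finset.sum_congr rfl fun i _ => ?_
  rw [mul_comm, mul_comm (c i), ← polyProj_mul (pderiv_mem_gradP hf i)]
  rw [show l + 1 + ((d - 1 : ℕ) : ℤ) = n by omega]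

lemma epi_gradPairingSheaf (hd : 1 ≤ d) (hf : f.IsHomogeneous d) (k : ℤ) :
    Epi (gradPairingSheaf hf k) := by
  refine (TopCat.Sheaf.isLocallySurjective_iff_epi (gradPairingSheaf hf k)).1 ?_
  refine (TopCat.Presheaf.isLocallySurjective_iff _).2 fun U t x hx => ?_
  obtain ⟨V, hV, ι, i, m, s, hm, hs, hy, h⟩ := t.2 ⟨x, hx⟩
  obtain ⟨B, hB, hBm⟩ := exists_field_of_mem_gradientIdeal hd hf (n := k + i) (l := k - d + i)
    (by ring) hm m.2
  refine ⟨V, ι.le, ⟨⟨fun y => LocalizedModule.mk B ⟨s, hy y⟩, fun y =>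
    ⟨V, y.2, 𝟙 V, i, B, s, hB, hs, hy, fun _ => rfl⟩⟩, ?_⟩, hV⟩
  refine Subtype.ext (funext fun y => ?_)
  refine Eq.trans ?_ (h y).symm
  refine (LocalizedModule.map_mk (S := compl y.1) (gradLin f) B ⟨s, hy y⟩).trans ?_
  congr 1
  exact Subtype.ext hBm

lemma gradPairing_euler (hf : f.IsHomogeneous d) (b : P r) :
    gradPairing f (b • fun i => X i) = b * (d * f) := by
  rw [map_smul, gradPairing_apply, hf.sum_X_mul_pderiv, nsmul_eq_mul, smul_eq_mul]

/-- After clearing denominators the field is `b` times the Euler field, and its pairing with the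
gradient is `b * d * f`. This vanishes only if `b = 0`. -/
lemma localizedField_eq_zero (hd : 1 ≤ d) (hf : f.IsHomogeneous d) (hf0 : f ≠ 0)
    (x : ProjectiveSpectrum (gradP r)) (z : LocalizedModule (compl x) (Fin (r + 1) → P r))
    (h1 : LocalizedModule.map (compl x) (gradLin f) z = 0)
    (h2 : LocalizedModule.map (compl x) (Submodule.mkQ (eulerSpan r)) z = 0) : z = 0 := by
  induction z using LocalizedModule.induction_on with
  | h A s =>
    rw [LocalizedModule.map_mk, localizedMk_eq_zero_iff] at h1 h2
    obtain ⟨u, hu, hu0⟩ := h1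
    obtain ⟨v, hv, hv0⟩ := h2
    have hA : gradPairing f A = 0 :=
      (mul_eq_zero.1 (congrArg Subtype.val hu0)).resolve_left (ne_zero_of_mem_compl hu)
    rw [← map_smul] at hv0
    obtain ⟨b, hb⟩ := Submodule.mem_span_singleton.1 ((Submodule.Quotient.mk_eq_zero _).1 hv0)
    have h3 := gradPairing_euler hf b
    rw [hb, map_smul, hA, smul_zero] at h3
    have hb0 : b = 0 := by
      rcases mul_eq_zero.1 h3.symm with h | h
      · exact h
      · exact absurd h (mul_ne_zero (Nat.cast_ne_zero.2 (by omega)) hf0)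
    rw [localizedMk_eq_zero_iff]
    exact ⟨v, hv, by rw [← hb, hb0, zero_smul]⟩

/-- Locally, logarithmic vector fields lift to vector fields on affine space which annihilate `f`. -/
lemma exists_local_lift (hd : 1 ≤ d) (hf : f.IsHomogeneous d) (k : ℤ) {U : Opens (ProjSpace r)}
    (t : (tangentSheaf r (k - d)).obj.obj (op U)) (ht : (eta hf k).hom.app (op U) t = 0)
    (x : ProjSpace r) (hx : x ∈ U) :
    ∃ (V : Opens (ProjSpace r)) (hVU : V ≤ U) (A : (fieldSheaf r (k - d)).obj.obj (op V)), x ∈ V ∧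
      (gradPairingSheaf hf k).hom.app (op V) A = 0 ∧
      (fieldToTangent (k - d)).hom.app (op V) A = TopCat.Presheaf.restrictOpen t V hVU := by
  obtain ⟨V, hV, ι, i, m, s, hm, hs, hy, h⟩ := t.2 ⟨x, hx⟩
  obtain ⟨A, hA, rfl⟩ := hm
  have h0 : LocalizedModule.map (compl x) (etaLin hf) (t.1 ⟨x, hx⟩) = 0 :=
    congrFun (congrArg Subtype.val ht) ⟨x, hx⟩
  have hAx : t.1 ⟨x, hx⟩ = LocalizedModule.mk (Submodule.Quotient.mk A) ⟨s, hy ⟨x, hV⟩⟩ := h ⟨x, hV⟩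
  rw [hAx, LocalizedModule.map_mk, localizedMk_eq_zero_iff] at h0
  obtain ⟨u, hu, hu0⟩ := h0
  obtain ⟨v, hv⟩ : ∃ v, v * f = u * gradPairing f A :=
    Ideal.mem_span_singleton'.1 ((Submodule.Quotient.mk_eq_zero _).1 (congrArg Subtype.val hu0))
  -- The multiplier `u` is not homogeneous; a component `w` not vanishing at `x`, with the matching
  -- component `v'` of `v`, satisfies the same relation.
  obtain ⟨n, hn⟩ := exists_homogeneous_notMem x hu
  have hgp := gradPairing_deg hf _ hA
  let w : P r := homogeneousComponent n u
  have hw : w ∈ gradP r n := homogeneousComponent_isHomogeneous n u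
  let v' : P r := polyProj r (k - d + i + n) v
  have hwv : w * gradPairing f A = f * v' := by
    rw [← polyProj_mul_of_mem hgp, ← hv, mul_comm v, ← polyProj_mul hf]
    rw [show k - d + i + n + (d : ℤ) = n + (k - d + i + d) by ring]
  have hd0 : (d : ℂ) ≠ 0 := Nat.cast_ne_zero.2 (by omega)
  -- By Euler's formula, subtracting `v' / d` times the Euler field cancels `w * gradPairing f A = f
  -- * v'`. The class modulo that field stays that of `w • A`, so the denominator becomes `s * w`.
  let B : Fin (r + 1) → P r := w • A - (C (d : ℂ)⁻¹ * v') • fun l => X l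
  have hB : gradPairing f B = 0 := by
    rw [map_sub, map_smul, gradPairing_euler hf, smul_eq_mul, hwv]
    have : (C (d : ℂ)⁻¹ : P r) * d = 1 := by
      rw [← map_natCast (C : ℂ →+* P r) d, ← C_mul, inv_mul_cancel₀ hd0, C_1]
    linear_combination (-v' * f) * this
  have hBdeg : B ∈ fieldPiece r (k - d + (i + n : ℕ)) := by
    intro l
    refine AddSubgroup.sub_mem _ (mul_mem_polyPiece hw (hA l) (by push_cast; ring)) ?_
    change C (d : ℂ)⁻¹ * v' * X l ∈ _
    rw [mul_right_comm]
    refine mul_mem_polyPiece (e := 1) ?_ (polyProj_mem (k - d + i + n) v) (by push_cast; ring)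
    have := (isHomogeneous_C (Fin (r + 1)) (d : ℂ)⁻¹).mul (isHomogeneous_X ℂ l)
    rwa [zero_add] at this
  let W : Opens (ProjSpace r) := V ⊓ ProjectiveSpectrum.basicOpen (gradP r) w
  have hW : ∀ y : W, s * w ∈ compl y.1 := fun y =>
    Submonoid.mul_mem _ (hy ⟨y.1, y.2.1⟩) y.2.2
  refine ⟨W, inf_le_left.trans ι.le, ⟨fun y => LocalizedModule.mk B ⟨s * w, hW y⟩, fun y =>
    ⟨W, y.2, 𝟙 W, i + n, B, s * w, hBdeg, SetLike.mul_mem_graded hs hw, hW, fun _ => rfl⟩⟩,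
    ⟨hV, hn⟩, ?_, ?_⟩
  · refine Subtype.ext (funext fun y => ?_)
    refine (LocalizedModule.map_mk (S := compl y.1) (gradLin f) B _).trans ?_
    have : gradLin f B = 0 := Subtype.ext hB
    rw [this, LocalizedModule.zero_mk]
    rfl
  · refine Subtype.ext (funext fun y => ?_)
    refine (LocalizedModule.map_mk (S := compl y.1) (Submodule.mkQ (eulerSpan r)) B _).trans ?_
    refine Eq.trans ?_ (h ⟨y.1, y.2.1⟩).symm
    have hBA : Submodule.mkQ (eulerSpan r) B = w • Submodule.mkQ (eulerSpan r) A := by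
      rw [map_sub, map_smul, sub_eq_self]
      exact (Submodule.Quotient.mk_eq_zero _).2
        (Submodule.smul_mem _ _ (Submodule.mem_span_singleton_self _))
    rw [hBA]
    refine LocalizedModule.mk_eq.2 ⟨1, ?_⟩
    simp only [one_smul, Submonoid.smul_def, smul_smul]
    rfl

/-- The kernel of `𝒪(1)^{r+1}(k - d) ⟶ J(f)^~(k)`. -/
def gradKernel (hf : f.IsHomogeneous d) (k : ℤ) : AbSheaf r :=
  Limits.kernel (gradPairingSheaf hf k)

/-- The inclusion of the kernel of `𝒪(1)^{r+1}(k - d) ⟶ J(f)^~(k)`. -/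
def gradKernelIncl (hf : f.IsHomogeneous d) (k : ℤ) : gradKernel hf k ⟶ fieldSheaf r (k - d) :=
  Limits.kernel.ι (gradPairingSheaf hf k)

instance (hf : f.IsHomogeneous d) (k : ℤ) : Mono (gradKernelIncl hf k) :=
  inferInstanceAs (Mono (Limits.kernel.ι (gradPairingSheaf hf k)))

lemma gradKernelIncl_comp (hf : f.IsHomogeneous d) (k : ℤ) :
    gradKernelIncl hf k ≫ gradPairingSheaf hf k = 0 := Limits.kernel.condition _

/-- The sequence `0 → ker → 𝒪(1)^{r+1}(k - d) → J(f)^~(k) → 0`. -/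
def gradSeq (hf : f.IsHomogeneous d) (k : ℤ) : ShortComplex (AbSheaf r) :=
  ShortComplex.mk (gradKernelIncl hf k) (gradPairingSheaf hf k) (Limits.kernel.condition _)

lemma gradSeq_shortExact (hd : 1 ≤ d) (hf : f.IsHomogeneous d) (k : ℤ) :
    (gradSeq hf k).ShortExact where
  exact := ShortComplex.exact_kernel _
  mono_f := inferInstanceAs (Mono (gradKernelIncl hf k))
  epi_g := epi_gradPairingSheaf hd hf k

/-- The projection of the kernel of `𝒪(1)^{r+1}(k - d) ⟶ J(f)^~(k)` to `T⟨X⟩(k - d)`. -/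
def gradKernelToLog (hf : f.IsHomogeneous d) (k : ℤ) : gradKernel hf k ⟶ logSheaf hf k :=
  Limits.kernel.map (gradPairingSheaf hf k) (eta hf k) (fieldToTangent (k - d))
    (gradientToJacobian f k) (gradPairingSheaf_comp hf k)

lemma gradKernelToLog_comp (hf : f.IsHomogeneous d) (k : ℤ) :
    gradKernelToLog hf k ≫ logIncl hf k = gradKernelIncl hf k ≫ fieldToTangent (k - d) :=
  Limits.kernel.lift_ι _ _ _

/-- The projection of the sequence of the gradient ideal onto the sequence of `T⟨X⟩`. -/
def gradSeqToLogSeq (hf : f.IsHomogeneous d) (k : ℤ) : gradSeq hf k ⟶ logSeq hf k where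
  τ₁ := gradKernelToLog hf k
  τ₂ := fieldToTangent (k - d)
  τ₃ := gradientToJacobian f k
  comm₁₂ := gradKernelToLog_comp hf k
  comm₂₃ := (gradPairingSheaf_comp hf k).symm

lemma mono_gradKernelToLog (hd : 1 ≤ d) (hf : f.IsHomogeneous d) (hf0 : f ≠ 0) (k : ℤ) :
    Mono (gradKernelToLog hf k) := by
  refine Preadditive.mono_of_cancel_zero _ fun {Z} t ht => ?_
  have h1 : (t ≫ gradKernelIncl hf k) ≫ fieldToTangent (k - d) = 0 := by
    rw [Category.assoc, ← gradKernelToLog_comp, ← Category.assoc, ht, Limits.zero_comp]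
  have h2 : (t ≫ gradKernelIncl hf k) ≫ gradPairingSheaf hf k = 0 := by
    rw [Category.assoc, gradKernelIncl_comp, Limits.comp_zero]
  rw [← cancel_mono (gradKernelIncl hf k), Limits.zero_comp]
  generalize t ≫ gradKernelIncl hf k = u at h1 h2
  ext U z
  refine Subtype.ext (funext fun x => ?_)
  refine localizedField_eq_zero hd hf hf0 x.1 _ ?_ ?_
  · have := congrArg (fun v => v.hom.app U z) h2
    exact congrFun (congrArg Subtype.val this) x
  · have := congrArg (fun v => v.hom.app U z) h1
    exact congrFun (congrArg Subtype.val this) x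

lemma epi_gradKernelToLog (hd : 1 ≤ d) (hf : f.IsHomogeneous d) (k : ℤ) :
    Epi (gradKernelToLog hf k) := by
  refine (TopCat.Sheaf.isLocallySurjective_iff_epi (gradKernelToLog hf k)).1 ?_
  refine (TopCat.Presheaf.isLocallySurjective_iff _).2 fun U t x hx => ?_
  obtain ⟨V, hVU, A, hxV, hA0, hAt⟩ := exists_local_lift hd hf k
    ((logIncl hf k).hom.app (op U) t) (by
      change (logIncl hf k ≫ eta hf k).hom.app (op U) t = 0
      rw [show logIncl hf k ≫ eta hf k = 0 from Limits.kernel.condition _]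
      rfl) x hx
  obtain ⟨A', hA'⟩ := TopCat.Sheaf.sections_exact_of_left_exact (S := gradSeq hf k)
    (ShortComplex.exact_kernel _) (inferInstanceAs (Mono (gradKernelIncl hf k))) A hA0
  refine ⟨V, hVU, ⟨A', ?_⟩, hxV⟩
  apply app_injective_of_mono (logIncl hf k) V
  refine Eq.trans ?_ (hAt.trans (TopCat.Presheaf.map_restrict (logIncl hf k).hom hVU t).symm)
  rw [← hA']
  exact congrArg (fun v => v.hom.app (op V) A') (gradKernelToLog_comp hf k)

lemma isIso_gradKernelToLog (hd : 1 ≤ d) (hf : f.IsHomogeneous d) (hf0 : f ≠ 0) (k : ℤ) :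
    IsIso (gradKernelToLog hf k) := by
  have := mono_gradKernelToLog hd hf hf0 k
  have := epi_gradKernelToLog hd hf k
  exact isIso_of_mono_of_epi _

/-! ### Global sections of the sheaf associated with the gradient ideal -/

/-- The group of global sections of `J(f)^~(k)`. -/
abbrev H0Gradient (f : P r) (k : ℤ) : Type := (gradientSheaf f k).obj.obj (op ⊤)

/-- The section `s` of `J(f)^~(k)` is given by the polynomial `a`. -/
def IsGivenBy {k : ℤ} (s : H0Gradient f k) (a : P r) : Prop :=
  ∀ x : (⊤ : Opens (ProjSpace r)), LocalizedModule.map (compl x.1)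
    (Submodule.subtype (gradientIdeal f : Submodule (P r) (P r))) (s.1 x) = LocalizedModule.mk a 1

/-- A polynomial in the saturation of the gradient ideal. -/
def IsSaturated (f a : P r) : Prop := ∃ N : ℕ, ∀ i : Fin (r + 1), X i ^ N * a ∈ gradientIdeal f

lemma map_subtype_injective (x : ProjectiveSpectrum (gradP r)) :
    Function.Injective (LocalizedModule.map (compl x)
      (Submodule.subtype (gradientIdeal f : Submodule (P r) (P r)))) :=
  LocalizedModule.map_injective _ _ (Submodule.subtype_injective _)

lemma IsGivenBy.unique {k : ℤ} {s s' : H0Gradient f k} {a : P r}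
    (h : IsGivenBy s a) (h' : IsGivenBy s' a) : s = s' :=
  Subtype.ext (funext fun x => map_subtype_injective x.1 ((h x).trans (h' x).symm))

lemma IsGivenBy.eq {k : ℤ} {s : H0Gradient f k} {a a' : P r}
    (h : IsGivenBy s a) (h' : IsGivenBy s a') : a = a' := by
  have := (h ⟨genericPt r, trivial⟩).symm.trans (h' ⟨genericPt r, trivial⟩)
  rw [mk_eq_mk_iff'] at this
  simpa using this

lemma IsGivenBy.sub {k : ℤ} {s s' : H0Gradient f k} {a a' : P r}
    (h : IsGivenBy s a) (h' : IsGivenBy s' a') : IsGivenBy (s - s') (a - a') := by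
  intro x
  refine (map_sub _ (s.1 x) (s'.1 x)).trans ?_
  rw [h x, h' x]
  exact (map_sub (LocalizedModule.mkLinearMap (compl x.1) (P r)) a a').symm

/-- As a section of `𝒪(k)`, `s` is a polynomial `a`. Its local denominators lie in the colon ideal
`(J(f) : a)` and have no common zero, so this ideal contains a power of each variable. -/
lemma exists_isGivenBy (hr : 1 ≤ r) {k : ℤ} (s : H0Gradient f k) :
    ∃ a ∈ polyPiece r k, IsSaturated f a ∧ IsGivenBy s a := by
  let t : sections (polyPiece r) k ⊤ :=
    (assocMap (𝓜 := gradientPiece f) (𝓝 := polyPiece r)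
      (Submodule.subtype (gradientIdeal f : Submodule (P r) (P r))) k k
      (fun _ _ hm => hm)).hom.app (op ⊤) s
  obtain ⟨a, ha, h⟩ := exists_eq_of_global_section hr t
  refine ⟨a, ha, ?_, h⟩
  obtain ⟨N, hN⟩ := exists_X_pow_mem
    (I := Submodule.colon (gradientIdeal f : Submodule (P r) (P r)) {a}) fun x => by
      obtain ⟨V, hV, ι, i, m, s', hm, hs, hx, hrep⟩ := s.2 ⟨x, trivial⟩
      refine ⟨i, s', hs, ?_, hx ⟨x, hV⟩⟩
      have h1 : t.1 ⟨x, trivial⟩ = _ := congrArg (LocalizedModule.map (compl x)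
        (Submodule.subtype (gradientIdeal f : Submodule (P r) (P r)))) (hrep ⟨x, hV⟩)
      rw [h, LocalizedModule.map_mk, mk_eq_mk_iff] at h1
      rw [Submodule.mem_colon_singleton, smul_eq_mul]
      change s' * a = 1 * m.1 at h1
      rw [h1, one_mul]
      exact m.2
  exact ⟨N, fun i => Submodule.mem_colon_singleton.1 (hN i)⟩

/-- Where `X i` does not vanish, take `(X i ^ N * a) / X i ^ N`. These fractions agree because
localization keeps `J(f)` inside `P r`, where all equal `a`. -/
lemma exists_section_of_isSaturated {k : ℤ} {a : P r} (ha : a ∈ polyPiece r k)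
    (hsat : IsSaturated f a) : ∃ s : H0Gradient f k, IsGivenBy s a := by
  obtain ⟨N, hN⟩ := hsat
  choose i hi using exists_X_notMem (r := r)
  have hi' : ∀ x, (X (i x) : P r) ^ N ∈ compl x := fun x => Submonoid.pow_mem _ (hi x) N
  have hval : ∀ (x : ProjectiveSpectrum (gradP r)) (j : Fin (r + 1))
      (hj : (X j : P r) ^ N ∈ compl x), LocalizedModule.map (compl x)
        (Submodule.subtype (gradientIdeal f : Submodule (P r) (P r)))
        (LocalizedModule.mk ⟨X j ^ N * a, hN j⟩ ⟨X j ^ N, hj⟩) = LocalizedModule.mk a 1 := by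
    intro x j hj
    rw [LocalizedModule.map_mk, mk_eq_mk_iff]
    exact one_mul _
  refine ⟨⟨fun x => LocalizedModule.mk ⟨X (i x.1) ^ N * a, hN _⟩ ⟨X (i x.1) ^ N, hi' x.1⟩,
    fun x => ?_⟩, fun x => hval x.1 _ _⟩
  have hX : (X (i x.1) : P r) ^ N ∈ gradP r (N * 1) := pow_mem_gradP (isHomogeneous_X ℂ _) N
  let V : Opens (ProjSpace r) := ProjectiveSpectrum.basicOpen (gradP r) (X (i x.1))
  refine ⟨V, hi x.1, homOfLE le_top, N * 1, ⟨X (i x.1) ^ N * a, hN _⟩, X (i x.1) ^ N,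
    mul_mem_polyPiece hX ha rfl, hX, fun y => Submonoid.pow_mem _ y.2 N, fun y => ?_⟩
  exact map_subtype_injective y.1 ((hval y.1 _ _).trans (hval y.1 _ _).symm)

/-! ### The connecting homomorphism -/

/-- The class `c ∈ H¹(T⟨X⟩(k - d))` is the image under the connecting homomorphism of the section of
`𝒥_{f/X}(k)` given by the polynomial `a`. -/
def IsConnectingClass (hf : f.IsHomogeneous d) {k : ℤ} (a : P r) (c : H1Log hf k) : Prop :=
  ∃ s : H0Gradient f k, IsGivenBy s a ∧
    connecting hf k ((gradientToJacobian f k).hom.app (op ⊤) s) = c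

lemma connecting_sub (hf : f.IsHomogeneous d) (k : ℤ) (s s' : H0Jacobian f k) :
    connecting hf k (s - s') = connecting hf k s - connecting hf k s' := by
  rw [connecting, map_sub]
  exact map_sub ((logSeq_shortExact hf k).extClass.postcomp _ (zero_add 1)) _ _

lemma IsConnectingClass.sub {hf : f.IsHomogeneous d} {k : ℤ} {a a' : P r} {c c' : H1Log hf k}
    (h : IsConnectingClass hf a c) (h' : IsConnectingClass hf a' c') :
    IsConnectingClass hf (a - a') (c - c') := by
  obtain ⟨s, hs, rfl⟩ := h
  obtain ⟨s', hs', rfl⟩ := h'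
  refine ⟨s - s', hs.sub hs', ?_⟩
  rw [← connecting_sub]
  congr 1
  exact map_sub ((gradientToJacobian f k).hom.app (op ⊤)).hom s s'

lemma comp_extClass_comp {𝒞 : Type*} [Category 𝒞] [Abelian 𝒞] [HasExt 𝒞] {S T : ShortComplex 𝒞}
    (hS : S.ShortExact) (hT : T.ShortExact) (φ : S ⟶ T) {Z : 𝒞} (q : Abelian.Ext Z S.X₃ 0) :
    (q.comp hS.extClass (zero_add 1)).comp (Abelian.Ext.mk₀ φ.τ₁) (add_zero 1) =
      (q.comp (Abelian.Ext.mk₀ φ.τ₃) (add_zero 0)).comp hT.extClass (zero_add 1) := by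
  rw [Abelian.Ext.comp_assoc_of_third_deg_zero, Abelian.Ext.comp_assoc_of_second_deg_zero,
    ShortComplex.ShortExact.extClass_naturality hS hT φ]

lemma comp_comp_extClass {𝒞 : Type*} [Category 𝒞] [Abelian 𝒞] [HasExt 𝒞] {S : ShortComplex 𝒞}
    (hS : S.ShortExact) {Z : 𝒞} (q : Abelian.Ext Z S.X₂ 0) :
    (q.comp (Abelian.Ext.mk₀ S.g) (add_zero 0)).comp hS.extClass (zero_add 1) = 0 := by
  rw [Abelian.Ext.comp_assoc_of_second_deg_zero, hS.comp_extClass, Abelian.Ext.comp_zero]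

/-- The connecting homomorphism of the sequence `0 → ker → 𝒪(1)^{r+1}(k - d) → J(f)^~(k) → 0`. -/
def gradConnecting (hd : 1 ≤ d) (hf : f.IsHomogeneous d) (k : ℤ)
    (s : H0Gradient f k) : Sheaf.H (gradKernel hf k) 1 :=
  ((Sheaf.H.equiv₀ (gradientSheaf f k) Limits.isTerminalTop).symm s).comp
    (gradSeq_shortExact hd hf k).extClass (zero_add 1)

/-- Naturality of the extension class under `gradSeqToLogSeq`. It transfers questions about
`connecting` to the sequence whose middle term has no `H¹`. -/
lemma map_gradConnecting (hd : 1 ≤ d) (hf : f.IsHomogeneous d) (k : ℤ)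
    (s : H0Gradient f k) :
    Sheaf.H.map (gradKernelToLog hf k) 1 (gradConnecting hd hf k s) =
      connecting hf k ((gradientToJacobian f k).hom.app (op ⊤) s) := by
  rw [connecting, ← Sheaf.H.equiv₀_symm_naturality]
  exact comp_extClass_comp (gradSeq_shortExact hd hf k) (logSeq_shortExact hf k)
    (gradSeqToLogSeq hf k) _

lemma bijective_map_gradKernelToLog (hd : 1 ≤ d) (hf : f.IsHomogeneous d) (hf0 : f ≠ 0) (k : ℤ) :
    Function.Bijective (Sheaf.H.map (gradKernelToLog hf k) 1) := by
  have := isIso_gradKernelToLog hd hf hf0 k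
  refine Function.bijective_iff_has_inverse.2
    ⟨Sheaf.H.map (inv (gradKernelToLog hf k)) 1, fun x => ?_, fun x => ?_⟩
  · rw [← Sheaf.H.map_comp_apply, IsIso.hom_inv_id, Sheaf.H.map_id_apply]
  · rw [← Sheaf.H.map_comp_apply, IsIso.inv_hom_id, Sheaf.H.map_id_apply]

/-- Here the vanishing of `H¹(𝒪(1)^{r+1}(k - d))` enters: every class of the kernel sheaf comes from
a section of `J(f)^~(k)`, that is, from a saturated polynomial. -/
lemma exists_isConnectingClass (hr : 2 ≤ r) (hd : 1 ≤ d) (hf : f.IsHomogeneous d) (hf0 : f ≠ 0)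
    {k : ℤ} (c : H1Log hf k) :
    ∃ a ∈ polyPiece r k, IsSaturated f a ∧ IsConnectingClass hf a c := by
  obtain ⟨c', rfl⟩ := (bijective_map_gradKernelToLog hd hf hf0 k).2 c
  have := subsingleton_H_one_fieldSheaf hr (k - d)
  obtain ⟨q, hq⟩ := Abelian.Ext.covariant_sequence_exact₁ _ (gradSeq_shortExact hd hf k) c'
    (Subsingleton.elim (α := Sheaf.H (fieldSheaf r (k - d)) 1) _ _) (zero_add 1)
  let s : H0Gradient f k :=
    Sheaf.H.equiv₀ (gradientSheaf f k) Limits.isTerminalTop q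
  obtain ⟨a, ha, hsat, hs⟩ := exists_isGivenBy (one_le_two.trans hr) s
  refine ⟨a, ha, hsat, s, hs, ?_⟩
  rw [← map_gradConnecting hd, gradConnecting]
  refine congrArg _ (Eq.trans ?_ hq)
  exact congrArg (fun e => Abelian.Ext.comp e (gradSeq_shortExact hd hf k).extClass (zero_add 1))
    (AddEquiv.symm_apply_apply _ q)

lemma isGivenBy_gradPairingSheaf (hf : f.IsHomogeneous d) {k : ℤ}
    (A : (fieldSheaf r (k - d)).obj.obj (op ⊤)) (B : Fin (r + 1) → P r)
    (hAB : ∀ x, A.1 x = LocalizedModule.mk B 1) :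
    IsGivenBy ((gradPairingSheaf hf k).hom.app (op ⊤) A) (gradPairing f B) := by
  intro x
  refine (localizedMap_comp (gradLin f) (Submodule.subtype _) (A.1 x)).trans ?_
  rw [hAB, LocalizedModule.map_mk]
  rfl

/-- By exactness the section lifts to a global vector field. Its coefficients are polynomials `B i`,
so `a = ∑ B i * ∂f/∂Xᵢ`. -/
lemma mem_gradientIdeal_of_isConnectingClass_zero (hr : 1 ≤ r) (hd : 1 ≤ d)
    (hf : f.IsHomogeneous d) (hf0 : f ≠ 0) {k : ℤ} {a : P r}
    (h : IsConnectingClass hf a (0 : H1Log hf k)) : a ∈ gradientIdeal f := by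
  obtain ⟨s, hs, h0⟩ := h
  rw [← map_gradConnecting hd] at h0
  have h1 : gradConnecting hd hf k s = 0 :=
    (bijective_map_gradKernelToLog hd hf hf0 k).1 (h0.trans (map_zero _).symm)
  obtain ⟨q, hq⟩ := Abelian.Ext.covariant_sequence_exact₃ _ (gradSeq_shortExact hd hf k) _
    (zero_add 1) h1
  let A : (fieldSheaf r (k - d)).obj.obj (op ⊤) :=
    Sheaf.H.equiv₀ (fieldSheaf r (k - d)) Limits.isTerminalTop q
  have hA : (gradPairingSheaf hf k).hom.app (op ⊤) A = s := by
    refine (Sheaf.H.equiv₀_naturality Limits.isTerminalTop (gradPairingSheaf hf k) q).trans ?_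
    exact (congrArg _ hq).trans (AddEquiv.apply_symm_apply _ s)
  have hcoeff : ∀ i, ∃ b : P r, ∀ x : (⊤ : Opens (ProjSpace r)),
      LocalizedModule.map (compl x.1) (LinearMap.proj i : (Fin (r + 1) → P r) →ₗ[P r] P r)
        (A.1 x) = LocalizedModule.mk b 1 := by
    intro i
    obtain ⟨b, -, hb⟩ := exists_eq_of_global_section hr
      ((fieldCoeff (k - d) i).hom.app (op ⊤) A)
    exact ⟨b, hb⟩
  choose B hB using hcoeff
  have hAB : ∀ x, A.1 x = LocalizedModule.mk B 1 := by
    intro x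
    have hBx := fun i => hB i x
    revert hBx
    generalize A.1 x = z
    induction z using LocalizedModule.induction_on with
    | h m t =>
      intro hBx
      refine LocalizedModule.mk_eq.2 ⟨1, ?_⟩
      rw [one_smul, one_smul, one_smul]
      funext i
      have := hBx i
      rw [LocalizedModule.map_mk, mk_eq_mk_iff', OneMemClass.coe_one, one_mul] at this
      exact this
  rw [← hA] at hs
  rw [hs.eq (isGivenBy_gradPairingSheaf hf A B hAB)]
  exact gradPairing_mem f B

/-- Such an `a` is the pairing of a homogeneous vector field with the gradient; the section then
lifts globally and the connecting homomorphism kills it. -/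
lemma IsConnectingClass.eq_zero_of_mem (hd : 1 ≤ d) {hf : f.IsHomogeneous d} {k : ℤ} {a : P r}
    {c : H1Log hf k} (h : IsConnectingClass hf a c) (ha : a ∈ polyPiece r k)
    (haJ : a ∈ gradientIdeal f) : c = 0 := by
  obtain ⟨s, hs, rfl⟩ := h
  obtain ⟨B, hB, rfl⟩ := exists_field_of_mem_gradientIdeal hd hf (l := k - d) (by ring) ha haJ
  let A : (fieldSheaf r (k - d)).obj.obj (op ⊤) := assocSection (fieldPiece r) (k - d) B hB
  have hsA : s = (gradPairingSheaf hf k).hom.app (op ⊤) A :=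
    hs.unique (isGivenBy_gradPairingSheaf hf A B fun _ => rfl)
  rw [← map_gradConnecting hd, hsA, gradConnecting, ← Sheaf.H.equiv₀_symm_naturality]
  exact (congrArg _ (comp_comp_extClass (gradSeq_shortExact hd hf k) _)).trans (map_zero _)

/-- Multiplication by a homogeneous polynomial as a morphism of exact sequences. -/
def logSeqMul (hf : f.IsHomogeneous d) {j : ℕ} (g : gradP r j) (k l : ℤ) (h : k + j = l) :
    logSeq hf k ⟶ logSeq hf l where
  τ₁ := logMul hf g k l h
  τ₂ := assocMul (quotPiece (fieldPiece r) (eulerSpan r)) g (k - d) (l - d) (by omega)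
  τ₃ := assocMul (jacobianPiece f) g k l h
  comm₁₂ := logMul_ι hf g k l h
  comm₂₃ := (eta_mul hf g k l h).symm

lemma logAct_connecting (hf : f.IsHomogeneous d) {j : ℕ} (g : gradP r j) (k l : ℤ) (h : k + j = l)
    (s : H0Jacobian f k) : logAct hf g k l h (connecting hf k s) =
      connecting hf l ((assocMul (jacobianPiece f) g k l h).hom.app (op ⊤) s) := by
  rw [connecting, connecting, ← Sheaf.H.equiv₀_symm_naturality]
  exact comp_extClass_comp (logSeq_shortExact hf k) (logSeq_shortExact hf l)
    (logSeqMul hf g k l h) _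

lemma IsConnectingClass.logAct {hf : f.IsHomogeneous d} {k l : ℤ} {a : P r} {c : H1Log hf k}
    (hc : IsConnectingClass hf a c) {j : ℕ} (g : gradP r j) (h : k + j = l) :
    IsConnectingClass hf (g.1 * a) (logAct hf g k l h c) := by
  obtain ⟨s, hs, rfl⟩ := hc
  refine ⟨(assocMul (gradientPiece f) g k l h).hom.app (op ⊤) s, fun x => ?_, ?_⟩
  · refine (localizedMap_comp (LinearMap.lsmul (P r) _ g.1) (Submodule.subtype _) (s.1 x)).trans ?_
    have h1 := hs x
    revert h1
    generalize s.1 x = z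
    induction z using LocalizedModule.induction_on with
    | h m t =>
      rw [LocalizedModule.map_mk, LocalizedModule.map_mk, mk_eq_mk_iff', mk_eq_mk_iff']
      intro h1
      change 1 * m.1 = t * a at h1
      change 1 * (g.1 * m.1) = t * (g.1 * a)
      linear_combination g.1 * h1
  · rw [logAct_connecting]
    congr 1
    refine Subtype.ext (funext fun x => ?_)
    refine (localizedMap_comp (LinearMap.lsmul (P r) _ g.1) (gradientProj f) (s.1 x)).trans ?_
    exact (localizedMap_comp (gradientProj f) (LinearMap.lsmul (P r) _ g.1) (s.1 x)).symm

/-- Links the gradient ideal sheaf to the sheaf on `X`: the required section is the image of the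
section of `J(f)^~(k)` given by `a`. -/
lemma exists_of_isSaturated (hf : f.IsHomogeneous d) {k : ℤ} {a : P r} (ha : a ∈ polyPiece r k)
    (hsat : IsSaturated f a) : ∃ s : H0Jacobian f k, H0JacobianIncl f k s = polySection f k a ha ∧
      IsConnectingClass hf a (connecting hf k s) := by
  obtain ⟨s, hs⟩ := exists_section_of_isSaturated ha hsat
  refine ⟨(gradientToJacobian f k).hom.app (op ⊤) s, ?_, s, hs, rfl⟩
  refine Subtype.ext (funext fun x => ?_)
  refine (localizedMap_comp (gradientProj f) (jacobianModule f).subtype (s.1 x)).trans ?_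
  have h1 := congrArg (LocalizedModule.map (compl x.1)
    (Submodule.mkQ (Ideal.span {f} : Submodule (P r) (P r)))) (hs x)
  rw [localizedMap_comp, LocalizedModule.map_mk] at h1
  exact h1

/-! ### The saturation of the gradient ideal and the local cohomology of the jacobian ring -/

lemma polyProj_mem_gradientIdeal (hf : f.IsHomogeneous d) {a : P r}
    (ha : a ∈ gradientIdeal f) (n : ℤ) : polyProj r n a ∈ gradientIdeal f := by
  obtain ⟨c, rfl⟩ := (Ideal.mem_span_range_iff_exists_fun).1 ha
  rw [map_sum]
  refine Ideal.sum_mem _ fun i _ => ?_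
  have := polyProj_mul (pderiv_mem_gradP hf i) (n - (d - 1 : ℕ)) (c i)
  rw [sub_add_cancel] at this
  rw [mul_comm, this]
  exact Ideal.mul_mem_right _ _ (Ideal.subset_span ⟨i, rfl⟩)

/-- The irrelevant ideal is finitely generated, so some power of it lies in `(J(f) : a)` as soon as
a power of each variable does. -/
lemma mk_mem_localCohomZero_iff {a : P r} :
    Ideal.Quotient.mk (gradientIdeal f) a ∈ localCohomZero f ↔ IsSaturated f a := by
  have hsmul : ∀ b : P r, b • Ideal.Quotient.mk (gradientIdeal f) a = 0 ↔
      b * a ∈ gradientIdeal f := fun b => Ideal.Quotient.eq_zero_iff_mem (a := b * a)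
  constructor
  · rintro ⟨n, hn⟩
    exact ⟨n, fun i => (hsmul _).1 (hn _ (Ideal.pow_mem_pow (Ideal.subset_span (Set.mem_range_self i))
      n))⟩
  · rintro ⟨N, hN⟩
    let I : Ideal (P r) := Submodule.colon (gradientIdeal f : Submodule (P r) (P r)) {a}
    have hle : Ideal.span (Set.range (X : Fin (r + 1) → P r)) ≤ I.radical := by
      refine Ideal.span_le.2 ?_
      rintro _ ⟨i, rfl⟩
      exact ⟨N, Submodule.mem_colon_singleton.2 (hN i)⟩
    obtain ⟨n, hn⟩ := Ideal.exists_pow_le_of_le_radical_of_fg hle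
      (Submodule.fg_span (Set.finite_range _))
    exact ⟨n, fun b hb => (hsmul b).2 (Submodule.mem_colon_singleton.1 (hn hb))⟩

lemma IsSaturated.homogeneousComponent (hf : f.IsHomogeneous d) {a : P r}
    (ha : IsSaturated f a) (n : ℕ) : IsSaturated f (homogeneousComponent n a) := by
  obtain ⟨N, hN⟩ := ha
  refine ⟨N, fun i => ?_⟩
  rw [← polyProj_natCast, ← polyProj_mul (pow_mem_gradP (isHomogeneous_X ℂ i) N)]
  exact polyProj_mem_gradientIdeal hf (hN i) _

/-- By Euler's formula a common zero of the partial derivatives is a zero of `f`, so nonsingularity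
leaves only the origin. The Nullstellensatz then puts a power of every variable in `J(f)`. -/
lemma localCohomZero_eq_top (hd : 1 ≤ d) (hf : f.IsHomogeneous d) (h : IsNonsingular f) :
    localCohomZero f = ⊤ := by
  have hX : ∀ i : Fin (r + 1), (X i : P r) ∈ (gradientIdeal f).radical := by
    intro i
    rw [← vanishingIdeal_zeroLocus_eq_radical (K := ℂ), mem_vanishingIdeal_iff]
    intro x hx
    have hx0 : ∀ j, eval x (pderiv j f) = 0 := fun j => by
      simpa using hx (pderiv j f) (Ideal.subset_span ⟨j, rfl⟩)
    have hfx : eval x f = 0 := by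
      have := congrArg (eval x) hf.sum_X_mul_pderiv
      rw [map_sum, nsmul_eq_mul, map_mul, map_natCast, Finset.sum_eq_zero fun j _ => by
        rw [map_mul, hx0, mul_zero]] at this
      exact (mul_eq_zero.1 this.symm).resolve_left (Nat.cast_ne_zero.2 (by omega))
    have : x = 0 := by
      by_contra hne
      obtain ⟨j, hj⟩ := h x hne hfx
      exact hj (hx0 j)
    simp [this]
  choose N hN using hX
  refine eq_top_iff.2 fun y _ => ?_
  obtain ⟨a, rfl⟩ := Ideal.Quotient.mk_surjective y
  refine mk_mem_localCohomZero_iff.2 ⟨Finset.univ.sup N, fun i => Ideal.mul_mem_right _ _ ?_⟩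
  exact (gradientIdeal f).pow_mem_of_pow_mem (hN i) (Finset.le_sup (f := N) (Finset.mem_univ i))

/-! ### The isomorphism -/

lemma IsConnectingClass.mk_eq (hr : 1 ≤ r) (hd : 1 ≤ d) {hf : f.IsHomogeneous d} (hf0 : f ≠ 0)
    {k : ℤ} {a a' : P r} {c : H1Log hf k} (h : IsConnectingClass hf a c)
    (h' : IsConnectingClass hf a' c) :
    Ideal.Quotient.mk (gradientIdeal f) a = Ideal.Quotient.mk (gradientIdeal f) a' := by
  refine Ideal.Quotient.eq.2 (mem_gradientIdeal_of_isConnectingClass_zero hr hd hf hf0 (k := k) ?_)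
  have := h.sub h'
  rwa [sub_self] at this

/-- Sending the image of a polynomial under the connecting homomorphism to its class in the jacobian
ring is a well-defined homomorphism. -/
lemma exists_classHom (hr : 2 ≤ r) (hd : 1 ≤ d) (hf : f.IsHomogeneous d) (hf0 : f ≠ 0) (k : ℤ) :
    ∃ Ψ : H1Log hf k →+ JacobianRing f, ∀ (a : P r) (c : H1Log hf k), IsConnectingClass hf a c →
      Ψ c = Ideal.Quotient.mk (gradientIdeal f) a := by
  have hr1 : 1 ≤ r := one_le_two.trans hr
  choose a ha hsat hconn using fun c : H1Log hf k => exists_isConnectingClass hr hd hf hf0 c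
  refine ⟨AddMonoidHom.ofMapSub (fun c => Ideal.Quotient.mk (gradientIdeal f) (a c))
    fun c c' => ?_, fun b c h => (hconn c).mk_eq hr1 hd hf0 h⟩
  rw [← map_sub]
  exact (hconn (c - c')).mk_eq hr1 hd hf0 ((hconn c).sub (hconn c'))

lemma exists_eq_sum_of (hf : f.IsHomogeneous d) (y : H1StarLog hf) :
    ∃ (s : Finset ℤ) (c : ∀ k, H1Log hf k), y = ∑ k ∈ s, H1StarLog.of hf k (c k) := by
  let _ : ∀ (k : ℤ) (x : H1Log hf k), Decidable (x ≠ 0) := fun _ _ => Classical.dec _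
  exact ⟨DFinsupp.support (β := fun k => H1Log hf k) y, fun k => DFinsupp.toFun y k,
    (DirectSum.sum_support_of (β := fun k => H1Log hf k) y).symm⟩

/-- Linearity is checked on homogeneous scalars and single summands, where
`IsConnectingClass.logAct` says that acting on the class multiplies the polynomial. -/
lemma exists_linearMap (hr : 2 ≤ r) (hd : 1 ≤ d) (hf : f.IsHomogeneous d) (hf0 : f ≠ 0) :
    ∃ Ψ : H1StarLog hf →ₗ[P r] JacobianRing f, ∀ (k : ℤ) (a : P r) (c : H1Log hf k),
      IsConnectingClass hf a c →
        Ψ (H1StarLog.of hf k c) = Ideal.Quotient.mk (gradientIdeal f) a := by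
  choose Ψ hΨ using exists_classHom hr hd hf hf0
  let Φ : H1StarLog hf →+ JacobianRing f :=
    (DirectSum.toAddMonoid Ψ : (⨁ k : ℤ, H1Log hf k) →+ JacobianRing f)
  have hΦ : ∀ (k : ℤ) (a : P r) (c : H1Log hf k), IsConnectingClass hf a c →
      Φ (H1StarLog.of hf k c) = Ideal.Quotient.mk (gradientIdeal f) a := fun k a c h =>
    (DirectSum.toAddMonoid_of Ψ k c).trans (hΨ k a c h)
  refine ⟨{ Φ with map_smul' := fun p y => ?_ }, hΦ⟩
  change Φ (p • y) = p • Φ y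
  obtain ⟨s, c, rfl⟩ := exists_eq_sum_of hf y
  rw [Finset.smul_sum, map_sum, map_sum, Finset.smul_sum]
  refine Finset.sum_congr rfl fun k _ => ?_
  generalize c k = c
  obtain ⟨a, -, -, hac⟩ := exists_isConnectingClass hr hd hf hf0 c
  induction p using DirectSum.Decomposition.inductionOn (gradP r) with
  | zero => rw [zero_smul, zero_smul, map_zero]
  | @homogeneous j g =>
    rw [H1StarLog.smul_of hf g k (k + j) rfl, hΦ _ _ _ (hac.logAct g rfl), hΦ _ _ _ hac]
    rfl
  | add p q hp hq => rw [add_smul, add_smul, map_add, hp, hq]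

/-- The summands of an element of the kernel give polynomials `a k` of distinct degrees with sum in
`J(f)`. This ideal is homogeneous, so each `a k` lies in it and each class is zero. -/
lemma injective_of_isConnectingClass (hr : 2 ≤ r) (hd : 1 ≤ d) (hf : f.IsHomogeneous d)
    (hf0 : f ≠ 0) (Ψ : H1StarLog hf →ₗ[P r] JacobianRing f)
    (hΨ : ∀ (k : ℤ) (a : P r) (c : H1Log hf k), IsConnectingClass hf a c →
      Ψ (H1StarLog.of hf k c) = Ideal.Quotient.mk (gradientIdeal f) a) :
    Function.Injective Ψ := by
  refine (injective_iff_map_eq_zero Ψ).2 fun y hy => ?_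
  obtain ⟨s, c, rfl⟩ := exists_eq_sum_of hf y
  choose a ha hsat hac using fun k => exists_isConnectingClass hr hd hf hf0 (c k)
  have hsum : ∑ k ∈ s, a k ∈ gradientIdeal f := by
    rw [← Ideal.Quotient.eq_zero_iff_mem, map_sum, ← hy, map_sum]
    exact Finset.sum_congr rfl fun k _ => (hΨ k _ _ (hac k)).symm
  refine Finset.sum_eq_zero fun k hk => ?_
  have hk' := polyProj_mem_gradientIdeal hf hsum k
  rw [map_sum, Finset.sum_eq_single_of_mem k hk fun l _ hl => ?_, polyProj_of_mem (ha k)] at hk'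
  · rw [(hac k).eq_zero_of_mem hd (ha k) hk', map_zero]
  · rcases ha l with h | ⟨n, rfl, hn⟩
    · rw [h, map_zero]
    · rcases lt_or_ge k 0 with hk0 | hk0
      · exact polyProj_of_neg hk0 _
      · lift k to ℕ using hk0
        rw [polyProj_natCast, homogeneousComponent_of_mem hn, if_neg]
        rintro rfl
        exact hl rfl

/-- Homogeneous components of a saturated polynomial are saturated, so each has a connecting class
that maps to it. -/
lemma range_of_isConnectingClass (hr : 2 ≤ r) (hd : 1 ≤ d) (hf : f.IsHomogeneous d)
    (hf0 : f ≠ 0) (Ψ : H1StarLog hf →ₗ[P r] JacobianRing f)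
    (hΨ : ∀ (k : ℤ) (a : P r) (c : H1Log hf k), IsConnectingClass hf a c →
      Ψ (H1StarLog.of hf k c) = Ideal.Quotient.mk (gradientIdeal f) a) :
    LinearMap.range Ψ = localCohomZero f := by
  refine le_antisymm ?_ fun y hy => ?_
  · rintro _ ⟨y, rfl⟩
    obtain ⟨s, c, rfl⟩ := exists_eq_sum_of hf y
    rw [map_sum]
    refine Submodule.sum_mem _ fun k _ => ?_
    obtain ⟨a, -, hsat, hac⟩ := exists_isConnectingClass hr hd hf hf0 (c k)
    rw [hΨ k a _ hac]
    exact mk_mem_localCohomZero_iff.2 hsat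
  · obtain ⟨a, rfl⟩ := Ideal.Quotient.mk_surjective y
    have hsat := mk_mem_localCohomZero_iff.1 hy
    rw [← sum_homogeneousComponent a, map_sum]
    refine Submodule.sum_mem _ fun n _ => ?_
    obtain ⟨t, -, ht⟩ := exists_of_isSaturated hf (k := n)
      (Or.inr ⟨n, rfl, homogeneousComponent_isHomogeneous n a⟩)
      (hsat.homogeneousComponent hf n)
    exact ⟨_, hΨ _ _ _ ht⟩

end LogSheaf

end

theorem proposition2p1 (r d : ℕ) (hr : 2 ≤ r) (hd : 1 ≤ d) (f : LogSheaf.P r)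
    (hf : f.IsHomogeneous d) (hred : Squarefree f) :
    ∃ φ : LogSheaf.localCohomZero f ≃ₗ[LogSheaf.P r] LogSheaf.H1StarLog hf,
      (∀ (k : ℤ) (a : LogSheaf.P r) (ha : a ∈ LogSheaf.polyPiece r k)
          (x : LogSheaf.localCohomZero f), x.1 = Ideal.Quotient.mk (LogSheaf.gradientIdeal f) a →
          ∃ s : LogSheaf.H0Jacobian f k,
            LogSheaf.H0JacobianIncl f k s = LogSheaf.polySection f k a ha ∧
            φ x = LogSheaf.H1StarLog.of hf k (LogSheaf.connecting hf k s)) ∧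
      (∀ (k : ℤ) (c : LogSheaf.H1Log hf k), ∃ a ∈ LogSheaf.polyPiece r k,
          ∃ x : LogSheaf.localCohomZero f, x.1 = Ideal.Quotient.mk (LogSheaf.gradientIdeal f) a ∧
            φ x = LogSheaf.H1StarLog.of hf k c) ∧
      (LogSheaf.IsNonsingular f →
        ∃ ψ : LogSheaf.JacobianRing f ≃ₗ[LogSheaf.P r] LogSheaf.H1StarLog hf,
          ∀ x : LogSheaf.localCohomZero f, ψ x.1 = φ x) := by
  have hf0 : f ≠ 0 := hred.ne_zero
  obtain ⟨Ψ, hΨ⟩ := LogSheaf.exists_linearMap hr hd hf hf0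
  let e : LogSheaf.H1StarLog hf ≃ₗ[LogSheaf.P r] LogSheaf.localCohomZero f :=
    (LinearEquiv.ofInjective Ψ
      (LogSheaf.injective_of_isConnectingClass hr hd hf hf0 Ψ hΨ)).trans
      (LinearEquiv.ofEq _ _ (LogSheaf.range_of_isConnectingClass hr hd hf hf0 Ψ hΨ))
  have he : ∀ y, (e y).1 = Ψ y := fun _ => rfl
  have hφ : ∀ (x : LogSheaf.localCohomZero f) (k : ℤ) (a : LogSheaf.P r) (c : LogSheaf.H1Log hf k),
      x.1 = Ideal.Quotient.mk (LogSheaf.gradientIdeal f) a → LogSheaf.IsConnectingClass hf a c →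
        e.symm x = LogSheaf.H1StarLog.of hf k c := by
    intro x k a c hx hc
    rw [LinearEquiv.symm_apply_eq]
    refine Subtype.ext ?_
    rw [hx, he, hΨ k a c hc]
  refine ⟨e.symm, fun k a ha x hx => ?_, fun k c => ?_, fun hns => ?_⟩
  · have hsat : LogSheaf.IsSaturated f a := LogSheaf.mk_mem_localCohomZero_iff.1 (hx ▸ x.2)
    obtain ⟨s, hs, hc⟩ := LogSheaf.exists_of_isSaturated hf ha hsat
    exact ⟨s, hs, hφ x k a _ hx hc⟩
  · obtain ⟨a, ha, hsat, hc⟩ := LogSheaf.exists_isConnectingClass hr hd hf hf0 c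
    exact ⟨a, ha, ⟨_, LogSheaf.mk_mem_localCohomZero_iff.2 hsat⟩, rfl, hφ _ k a c rfl hc⟩
  -- For nonsingular `X` the local cohomology is all of `R(f)`, and `ψ` is `φ` under this
  -- identification.
  · exact ⟨(LinearEquiv.ofTop _ (LogSheaf.localCohomZero_eq_top hd hf hns)).symm.trans e.symm,
      fun x => rfl⟩
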